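/- **Notation.** Let $n\ge 1$ and let $C^n=(\Delta^1)^n$ be the simplicial $n$-cube. Its boundary $\partial C^n$ is the union of the faces $\{x_i=j\}$ ($1\le i\le n$, $j\in\{0,1\}$), and the *left box* $LC^n\subset C^n$ is the union of all these faces except $\{x_n=1\}$. Let $J^n\subseteq C^n$ be the simplicial subset that is the union of $LC^n$ and of all nondegenerate $n$-simplices of $C^n$ whose spine does not begin with $(0,\dots,0,0)\to(0,\dots,0,1)$. For $0\le j\le n$ let $a^j:\Delta^n\to\Delta^1$ be the map that sends the vertices $0,\dots,j-1$ to $0$ and the vertices $j,\dots,n$ to $1$. For a permutation $\tau\in S_n$ let $\phi(\tau)=(a^{\tau(1)},\dots,a^{\tau(n)}):\Delta^n\to C^n$. Order $S_n$ by $\tau<\tau'$ if and only if there is $k$ with $\tau^{-1}(i)=\tau'^{-1}(i)$ for all $i<k$ and $\tau^{-1}(k)<\tau'^{-1}(k)$. Put $F_\tau=LC^n\cup\bigcup_{\tau'<\tau}\phi(\tau')$. A permutation $\tau$ is also written $(\tau(1),\dots,\tau(n))$. Let $\star$ denote the join of simplicial sets. *Marked anodyne* means cocartesian-marked anodyne: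 it is the smallest class of morphisms of marked simplicial sets that is stable under pushouts, transfinite compositions and retracts and that contains: the inner horn inclusions with flat markings (only degenerate edges marked); the inclusions $\Lambda^m_0\to\Delta^m$, $m\ge1$, where in $\Delta^m$ the edge $\Delta^{\{0,1\}}$ and the degenerate edges are marked and $\Lambda^m_0$ has the restricted marking; the map $(\Lambda^2_1)^\sharp\cup(\Delta^2)^\flat\to(\Delta^2)^\sharp$; and $K^\flat\to K^\sharp$ for every Kan complex $K$. Here $\flat$ and $\sharp$ denote the markings by the degenerate edges and by all edges. **Proposition.** For every $n\ge1$ the inclusion $LC^n\subset C^n$ is a composite of inclusions $$LC^n\overset{i}{\hookrightarrow}J^n\overset{j}{\hookrightarrow}C^n$$ with the following properties. 1. The map $i$ is inner anodyne. More precisely, $J^n=F_{(2,3,\dots,n,1)}$, and for every $\tau<(2,3,\dots,n,1)$ the inclusion $F_\tau\hookrightarrow F_\tau\cup\phi(\tau)$ is inner anodyne. 2. There is a pushout square of simplicial sets, all of whose maps are monomorphisms, $$\begin{array}{ccc}\Delta^0\star\partial C^{n-1}&\hookrightarrow&\Delta^0\star C^{n-1}\\ \downarrow&&\downarrow\\ J^n&\overset{j}{\hookrightarrow}&C^n\end{array}$$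 where the top map is induced by $\partial C^{n-1}\subset C^{n-1}$, and the right-hand map sends $\Delta^0$ to $(0,\dots,0)$, restricts to $x\mapsto(x,1)$ on $C^{n-1}$, and sends the edge from the cone point to the vertex $(0,\dots,0)$ of $C^{n-1}$ to $(0,\dots,0,0)\to(0,\dots,0,1)$. 3. The top map of this square underlies a marked anodyne morphism $(\Delta^0\star\partial C^{n-1},\mathcal G)\hookrightarrow(\Delta^0\star C^{n-1},\mathcal G)$, where on $\Delta^0\star C^{n-1}$ the marking $\mathcal G$ consists of the degenerate edges and the edge $(0,\dots,0,0)\to(0,\dots,0,1)$, and on $\Delta^0\star\partial C^{n-1}$ it is the restriction of this marking. -/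

import Mathlib

open CategoryTheory Opposite Simplicial Limits

universe u

namespace CubeFilling

/-! ### Cubes -/

/-- The `n`-cube `Cⁿ = (Δ¹)ⁿ`: the `n`-fold product of `Δ[1]`, computed degreewise. -/
def cube (n : ℕ) : SSet.{u} where
  obj m := Fin n → (Δ[1] : SSet.{u}).obj m
  map f := ↾ fun x i ↦ (Δ[1] : SSet.{u}).map f (x i)

/-- The face of `Cⁿ` on which the `i`-th coordinate is constantly equal to `j`. -/
def cubeFace (n : ℕ) (i : Fin n) (j : Fin 2) : (cube.{u} n).Subcomplex where
  obj m := {x | x i = SSet.stdSimplex.const 1 j m}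
  map {m m'} f x hx := by
    change (Δ[1] : SSet.{u}).map f (x i) = _
    rw [show x i = _ from hx]
    rfl

/-- The boundary `∂Cⁿ`: the union of all faces. -/
def cubeBoundary (n : ℕ) : (cube.{u} n).Subcomplex :=
  ⨆ (i : Fin n) (j : Fin 2), cubeFace n i j

/-- The left box `LCⁿ⁺¹ ⊆ Cⁿ⁺¹`: the union of all faces except for the one on which
the last coordinate is `1`. -/
def leftBox (n : ℕ) : (cube.{u} (n + 1)).Subcomplex :=
  ⨆ (p : Fin (n + 1) × Fin 2) (_ : p ≠ (Fin.last n, 1)), cubeFace (n + 1) p.1 p.2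

/-- The vertex `(0, …, 0)` of `Cⁿ`. -/
def cubeZero (n : ℕ) : (cube.{u} n) _⦋0⦌ := fun _ ↦ SSet.stdSimplex.const 1 0 _

/-- The edge `(0, …, 0, 0) → (0, …, 0, 1)` of `Cⁿ⁺¹`. -/
def cubeInitialEdge (n : ℕ) : (cube.{u} (n + 1)) _⦋1⦌ :=
  fun i ↦ if i = Fin.last n then SSet.stdSimplex.edge 1 0 1 (Fin.zero_le _)
    else SSet.stdSimplex.const 1 0 _

/-- The inclusion `Cⁿ → Cⁿ⁺¹`, `x ↦ (x, 1)`, of the face on which the last coordinate is `1`. -/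
def rightFaceInclusion (n : ℕ) : cube.{u} n ⟶ cube.{u} (n + 1) where
  app m := ↾ fun (x : Fin n → (Δ[1] : SSet.{u}).obj m) ↦ (fun i ↦
    if h : i.val < n then x ⟨i.val, h⟩ else SSet.stdSimplex.const 1 1 m :
      Fin (n + 1) → (Δ[1] : SSet.{u}).obj m)
  naturality m m' f := by
    ext x
    funext i
    change (if h : i.val < n then (Δ[1] : SSet.{u}).map f (x ⟨i.val, h⟩)
        else SSet.stdSimplex.const 1 1 m') =
      (Δ[1] : SSet.{u}).map f (if h : i.val < n then x ⟨i.val, h⟩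
        else SSet.stdSimplex.const 1 1 m)
    split_ifs
    · rfl
    · rfl

/-- The spine of the `(d + 1)`-simplex `σ` of `Cⁿ⁺¹` begins with
`(0, …, 0, 0) → (0, …, 0, 1)`; here `σ i k` is the `i`-th coordinate of the `k`-th vertex. -/
def SpineBeginsLast {n d : ℕ} (σ : (cube.{u} (n + 1)) _⦋d + 1⦌) : Prop :=
  ∀ i : Fin (n + 1),
    (σ i : (Δ[1] : SSet.{u}) _⦋d + 1⦌) 0 = 0 ∧
    (σ i : (Δ[1] : SSet.{u}) _⦋d + 1⦌) 1 = if i = Fin.last n then 1 else 0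

/-- `Jⁿ⁺¹ ⊆ Cⁿ⁺¹`: the union of the left box and of all nondegenerate `(n + 1)`-simplices
whose spine does not begin with `(0, …, 0, 0) → (0, …, 0, 1)`. -/
def cubeJ (n : ℕ) : (cube.{u} (n + 1)).Subcomplex :=
  leftBox n ⊔ ⨆ (σ : (cube.{u} (n + 1)) _⦋n + 1⦌)
    (_ : σ ∈ (cube.{u} (n + 1)).nonDegenerate (n + 1) ∧ ¬ SpineBeginsLast σ),
      SSet.Subcomplex.ofSimplex σ

/-! ### The ordered filling -/

/-- The `n`-simplex `φ(τ) = (a^{τ(1)}, …, a^{τ(n)})` of `Cⁿ`, where `aʲ : Δⁿ → Δ¹` sends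
the first `j` vertices to `0` and the other ones to `1`. As `Fin n` starts at `0`, the number
`τ(i)` of the mathematical notation is `τ i + 1` here. -/
def permSimplex {n : ℕ} (τ : Equiv.Perm (Fin n)) : (cube.{u} n) _⦋n⦌ :=
  fun i ↦ SSet.stdSimplex.objMk₁ (τ i).succ.castSucc

/-- The strict order on permutations: `τ < τ'` if `τ⁻¹` is lexicographically smaller
than `τ'⁻¹`. -/
def PermLT {n : ℕ} (τ τ' : Equiv.Perm (Fin n)) : Prop :=
  ∃ k : Fin n, (∀ i < k, τ.symm i = τ'.symm i) ∧ τ.symm k < τ'.symm k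

/-- The union of the left box and of all simplices `φ(τ')` with `τ' < τ`. -/
def cubeFiltration (n : ℕ) (τ : Equiv.Perm (Fin (n + 1))) : (cube.{u} (n + 1)).Subcomplex :=
  leftBox n ⊔ ⨆ (τ' : Equiv.Perm (Fin (n + 1))) (_ : PermLT τ' τ),
    SSet.Subcomplex.ofSimplex (permSimplex τ')

/-! ### Joins -/

/-- An `m`-simplex of the join `X ⋆ Y`. It consists of a map `cut : Δᵐ → Δ¹` (that is, a
decomposition of `[m]` into an initial segment `cut⁻¹(0)` and a final segment `cut⁻¹(1)`,
either of which may be empty), a map `left` from the subcomplex of `Δᵐ` on `cut⁻¹(0)` to `X`,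
and a map `right` from the subcomplex of `Δᵐ` on `cut⁻¹(1)` to `Y`. So if `cut⁻¹(0)` and
`cut⁻¹(1)` have `p + 1` and `q + 1` elements, this is a `p`-simplex of `X` and a `q`-simplex
of `Y`, with no datum for an empty segment. -/
structure JoinSimplex (X Y : SSet.{u}) (m : SimplexCategory) : Type u where
  cut : m ⟶ ⦋1⦌
  left : ∀ (k : SimplexCategory) (g : k ⟶ m),
    (∀ i, (g ≫ cut).toOrderHom i = 0) → X.obj (op k)
  right : ∀ (k : SimplexCategory) (g : k ⟶ m),
    (∀ i, (g ≫ cut).toOrderHom i = 1) → Y.obj (op k)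
  map_left : ∀ (k l : SimplexCategory) (h : l ⟶ k) (g : k ⟶ m)
    (hg : ∀ i, (g ≫ cut).toOrderHom i = 0) (hhg : ∀ i, ((h ≫ g) ≫ cut).toOrderHom i = 0),
    X.map h.op (left k g hg) = left l (h ≫ g) hhg
  map_right : ∀ (k l : SimplexCategory) (h : l ⟶ k) (g : k ⟶ m)
    (hg : ∀ i, (g ≫ cut).toOrderHom i = 1) (hhg : ∀ i, ((h ≫ g) ≫ cut).toOrderHom i = 1),
    Y.map h.op (right k g hg) = right l (h ≫ g) hhg

theorem JoinSimplex.ext' {X Y : SSet.{u}} {m : SimplexCategory} {s t : JoinSimplex X Y m}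
    (hcut : s.cut = t.cut)
    (hleft : ∀ k g hs ht, s.left k g hs = t.left k g ht)
    (hright : ∀ k g hs ht, s.right k g hs = t.right k g ht) : s = t := by
  obtain ⟨c, l, r, _, _⟩ := s
  obtain ⟨c', l', r', _, _⟩ := t
  obtain rfl : c = c' := hcut
  obtain rfl : l = l' := by
    funext k g h
    exact hleft k g h h
  obtain rfl : r = r' := by
    funext k g h
    exact hright k g h h
  rfl

/-- Restriction of a simplex of the join along `f : Δᵐ' → Δᵐ`. -/
def JoinSimplex.restrict {X Y : SSet.{u}} {m m' : SimplexCategory} (f : m' ⟶ m)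
    (s : JoinSimplex X Y m) : JoinSimplex X Y m' where
  cut := f ≫ s.cut
  left k g hg := s.left k (g ≫ f) (by simpa only [Category.assoc] using hg)
  right k g hg := s.right k (g ≫ f) (by simpa only [Category.assoc] using hg)
  map_left k l h g hg hhg := by
    simpa only [Category.assoc] using s.map_left k l h (g ≫ f)
      (by simpa only [Category.assoc] using hg) (by simpa only [Category.assoc] using hhg)
  map_right k l h g hg hhg := by
    simpa only [Category.assoc] using s.map_right k l h (g ≫ f)
      (by simpa only [Category.assoc] using hg) (by simpa only [Category.assoc] using hhg)

/-- The join `X ⋆ Y` of two simplicial sets. -/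
def join (X Y : SSet.{u}) : SSet.{u} where
  obj m := JoinSimplex X Y m.unop
  map f := ↾ JoinSimplex.restrict f.unop
  map_id m := by
    ext s
    refine JoinSimplex.ext' (Category.id_comp _) (fun k g hs ht ↦ ?_) (fun k g hs ht ↦ ?_)
    · change s.left k (g ≫ 𝟙 _) _ = s.left k g _
      congr 1
      exact Category.comp_id g
    · change s.right k (g ≫ 𝟙 _) _ = s.right k g _
      congr 1
      exact Category.comp_id g
  map_comp {m m' m''} f f' := by
    ext s
    refine JoinSimplex.ext' (Category.assoc _ _ _) (fun k g hs ht ↦ ?_) (fun k g hs ht ↦ ?_)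
    · change s.left k (g ≫ (f'.unop ≫ f.unop)) _ = s.left k ((g ≫ f'.unop) ≫ f.unop) _
      congr 1
    · change s.right k (g ≫ (f'.unop ≫ f.unop)) _ = s.right k ((g ≫ f'.unop) ≫ f.unop) _
      congr 1

/-- Functoriality of the join. -/
def joinMap {X X' Y Y' : SSet.{u}} (p : X ⟶ X') (q : Y ⟶ Y') : join X Y ⟶ join X' Y' where
  app m := ↾ fun (s : JoinSimplex X Y m.unop) ↦ ({
    cut := s.cut
    left := fun k g hg ↦ p.app _ (s.left k g hg)
    right := fun k g hg ↦ q.app _ (s.right k g hg)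
    map_left := fun k l h g hg hhg ↦ by
      rw [← s.map_left k l h g hg hhg]
      exact (NatTrans.naturality_apply p h.op _).symm
    map_right := fun k l h g hg hhg ↦ by
      rw [← s.map_right k l h g hg hhg]
      exact (NatTrans.naturality_apply q h.op _).symm } : JoinSimplex X' Y' m.unop)
  naturality _ _ _ := rfl

/-- The inclusion `X → X ⋆ Y`. -/
def joinInl (X Y : SSet.{u}) : X ⟶ join X Y where
  app m := ↾ fun (x : X.obj m) ↦ ({
    cut := SimplexCategory.const _ ⦋1⦌ 0
    left := fun k g _ ↦ X.map g.op x
    right := fun k g hg ↦ absurd (hg 0) (show ¬ (0 : Fin 2) = 1 by decide)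
    map_left := fun k l h g _ _ ↦ by simp
    map_right := fun k l h g hg _ ↦ absurd (hg 0) (show ¬ (0 : Fin 2) = 1 by decide) } :
      JoinSimplex X Y m.unop)
  naturality m m' f := by
    ext x
    refine JoinSimplex.ext' rfl (fun k g hs ht ↦ ?_)
      (fun k g hs ht ↦ absurd (hs 0) (show ¬ (0 : Fin 2) = 1 by decide))
    change X.map g.op (X.map f x) = X.map (g ≫ f.unop).op x
    simp

/-- The inclusion `Y → X ⋆ Y`. -/
def joinInr (X Y : SSet.{u}) : Y ⟶ join X Y where
  app m := ↾ fun (y : Y.obj m) ↦ ({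
    cut := SimplexCategory.const _ ⦋1⦌ 1
    left := fun k g hg ↦ absurd (hg 0) (show ¬ (1 : Fin 2) = 0 by decide)
    right := fun k g _ ↦ Y.map g.op y
    map_left := fun k l h g hg _ ↦ absurd (hg 0) (show ¬ (1 : Fin 2) = 0 by decide)
    map_right := fun k l h g _ _ ↦ by simp } : JoinSimplex X Y m.unop)
  naturality m m' f := by
    ext y
    refine JoinSimplex.ext' rfl
      (fun k g hs ht ↦ absurd (hs 0) (show ¬ (1 : Fin 2) = 0 by decide)) (fun k g hs ht ↦ ?_)
    change Y.map g.op (Y.map f y) = Y.map (g ≫ f.unop).op y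
    simp

/-- The edge of `X ⋆ Y` from a vertex `x` of `X` to a vertex `y` of `Y`. -/
def joinEdge {X Y : SSet.{u}} (x : X _⦋0⦌) (y : Y _⦋0⦌) : (join X Y) _⦋1⦌ :=
  ({ cut := 𝟙 ⦋1⦌
     left := fun k _ _ ↦ X.map (SimplexCategory.const k ⦋0⦌ 0).op x
     right := fun k _ _ ↦ Y.map (SimplexCategory.const k ⦋0⦌ 0).op y
     map_left := fun k l h g _ _ ↦ by
      rw [← ConcreteCategory.comp_apply, ← X.map_comp]
      rfl
     map_right := fun k l h g _ _ ↦ by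
      rw [← ConcreteCategory.comp_apply, ← Y.map_comp]
      rfl } : JoinSimplex X Y ⦋1⦌)

/-! ### Marked simplicial sets -/

/-- A marked simplicial set: a simplicial set with a set of marked edges that contains
all degenerate edges. -/
structure MarkedSSet : Type (u + 1) where
  toSSet : SSet.{u}
  marked : Set (toSSet _⦋1⦌)
  degenerate_le : toSSet.degenerate 1 ⊆ marked

namespace MarkedSSet

/-- A morphism of marked simplicial sets: a map that sends marked edges to marked edges. -/
@[ext]
structure Hom (X Y : MarkedSSet.{u}) : Type u where
  map : X.toSSet ⟶ Y.toSSet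
  map_marked : ∀ e ∈ X.marked, map.app _ e ∈ Y.marked

instance : Category MarkedSSet.{u} where
  Hom X Y := Hom X Y
  id X := ⟨𝟙 _, fun _ he ↦ he⟩
  comp f g := ⟨f.map ≫ g.map, fun e he ↦ g.map_marked _ (f.map_marked e he)⟩

/-- The flat marking `X♭`: only the degenerate edges are marked. -/
def flat (X : SSet.{u}) : MarkedSSet.{u} := ⟨X, X.degenerate 1, subset_rfl⟩

/-- The sharp marking `X♯`: all edges are marked. -/
def sharp (X : SSet.{u}) : MarkedSSet.{u} := ⟨X, Set.univ, Set.subset_univ _⟩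

/-- The marking by the degenerate edges and the edges in a given set. -/
def withEdges (X : SSet.{u}) (S : Set (X _⦋1⦌)) : MarkedSSet.{u} :=
  ⟨X, X.degenerate 1 ∪ S, Set.subset_union_left⟩

/-- The restriction of the marking of `Y` along a map `f : X → Y`. -/
def restrict {X : SSet.{u}} (Y : MarkedSSet.{u}) (f : X ⟶ Y.toSSet) : MarkedSSet.{u} :=
  ⟨X, {e | f.app _ e ∈ Y.marked},
    fun _ he ↦ Y.degenerate_le (SSet.degenerate_app_apply he f)⟩

/-- The map `f`, as a morphism from `X` with the restricted marking. -/
def restrictHom {X : SSet.{u}} (Y : MarkedSSet.{u}) (f : X ⟶ Y.toSSet) : Y.restrict f ⟶ Y :=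
  Hom.mk f (fun _ he ↦ he)

/-- The generators of the class of (cocartesian) marked anodyne morphisms. -/
inductive AnodyneGenerators : MorphismProperty MarkedSSet.{u}
  /-- inner horn inclusions with the flat markings -/
  | inner (n : ℕ) (i : Fin (n + 1)) (h0 : 0 < i) (hn : i < Fin.last n) :
    AnodyneGenerators (X := flat (Λ[n, i] : SSet.{u})) (Y := flat Δ[n])
      (Hom.mk (SSet.horn n i).ι (fun _ he ↦ SSet.degenerate_app_apply he _))
  /-- left horn inclusions `Λⁿ⁺¹₀ → Δⁿ⁺¹`, where `Δ^{0, 1}` is marked -/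
  | left (n : ℕ) :
    AnodyneGenerators (restrictHom
      (withEdges (Δ[n + 1] : SSet.{u}) {SSet.stdSimplex.edge (n + 1) 0 1 (Fin.zero_le _)})
      (SSet.horn (n + 1) 0).ι)
  /-- `(Λ²₁)♯ ∪ (Δ²)♭ → (Δ²)♯` -/
  | comp :
    AnodyneGenerators
      (X := withEdges (Δ[2] : SSet.{u}) ((SSet.horn 2 1).obj (op ⦋1⦌))) (Y := sharp Δ[2])
      (Hom.mk (𝟙 _) (fun _ _ ↦ trivial))
  /-- `K♭ → K♯` for a Kan complex `K` -/
  | kan (K : SSet.{u}) (hK : SSet.KanComplex K) :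
    AnodyneGenerators (X := flat K) (Y := sharp K) (Hom.mk (𝟙 _) (fun _ _ ↦ trivial))

/-- The class of (cocartesian) marked anodyne morphisms: the smallest weakly saturated class
(that is, stable under pushouts, transfinite compositions and retracts) that contains
the generators. -/
def markedAnodyne : MorphismProperty MarkedSSet.{u} := fun _ _ f ↦
  ∀ W : MorphismProperty MarkedSSet.{u},
    W.IsStableUnderCobaseChange →
    MorphismProperty.IsStableUnderTransfiniteComposition.{u} W →
    W.IsStableUnderRetracts →
    AnodyneGenerators ≤ W → W f

end MarkedSSet

/-- The cone `Δ⁰ ⋆ Cⁿ`, where the degenerate edges and the edge from the cone point to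
the vertex `(0, …, 0)` of `Cⁿ` are marked. -/
def markedCone (n : ℕ) : MarkedSSet.{u} :=
  MarkedSSet.withEdges (join Δ[0] (cube.{u} n))
    {joinEdge (SSet.stdSimplex.const 0 0 _) (cubeZero n)}

/-- The inclusion `Δ⁰ ⋆ ∂Cⁿ → Δ⁰ ⋆ Cⁿ`. -/
def coneInclusion (n : ℕ) :
    join (Δ[0] : SSet.{u}) (cubeBoundary.{u} n) ⟶ join (Δ[0] : SSet.{u}) (cube.{u} n) :=
  joinMap (𝟙 _) (cubeBoundary n).ι

end CubeFilling

/-!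
A simplex of `Cⁿ` is a monotone sequence of vertices in the poset `{0, 1}ⁿ` (`vert`, `ofVert`),
so every question about simplices is a question about chains in this poset. A chain is contained
in the maximal chain `φ(τ)` if and only if `τ` lists the coordinates in the order in which they
jump to `1` (`mem_ofSimplex_permSimplex_iff`). It follows that, outside of the left box, `Jⁿ⁺¹`
consists of the chains along which some coordinate other than the last one dominates the last one
(`mem_cubeJ_iff`).

Both anodyne statements come from one filling lemma, `cone_induction`: if adding a vertex `p` to a
chain never leads out of `B`, and never leads from outside of `A` into `A`, then `B` arises from `A`
by filling horns `Λᵐ⁺¹ₖ` along chains with `k`-th vertex `p`.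

* For `F_τ ⊆ F_τ ∪ φ(τ)`, a subchain of `φ(τ)` lies outside of `F_τ` if and only if it contains the
  first vertex, the last vertex, and all vertices at the descents of `τ⁻¹`
  (`mem_cubeFiltration_iff_exists_not_mem_range`). If `τ` is smaller than `(2, …, n + 1, 1)`, then
  `τ⁻¹` does not start with the last coordinate and hence has an ascent. The vertex there serves
  as `p`; the horns are inner because the first and the last vertex are always present.
* The map `Δ⁰ ⋆ Cⁿ → Cⁿ⁺¹` is a monomorphism onto the chains along which the last coordinate
  dominates all others. Each chain is of this kind or in `J`, and it is both exactly if it comes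
  from `Δ⁰ ⋆ ∂Cⁿ` (`coneToCube_mem_cubeJ_iff`); this gives the pushout square. The vertex
  `p = (0, …, 0)` satisfies the hypotheses of the filling lemma for the inclusion of this
  intersection in the image. In the image, all chains outside of `J` have `(0, …, 0, 1)` as
  their first vertex other than `p`, so that the horns are left horns with marked first edge
  (`markedHomOfLE_cubeJ_inf_range`).
-/

namespace CubeFilling

/-! ### Vertices of simplices of the cube -/

/-- The vertices of a simplex of the cube, as points of the poset `{0, 1}ⁿ`. -/
def vert {n m : ℕ} (x : (cube.{u} n) _⦋m⦌) (v : Fin (m + 1)) : Fin n → Fin 2 :=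
  fun i ↦ (x i : (Δ[1] : SSet.{u}) _⦋m⦌) v

lemma vert_monotone {n m : ℕ} (x : (cube.{u} n) _⦋m⦌) : Monotone (vert x) :=
  fun _ _ h i ↦ SSet.stdSimplex.monotone_apply (x i) h

lemma cube_ext {n m : ℕ} {x y : (cube.{u} n) _⦋m⦌} (h : ∀ v, vert x v = vert y v) : x = y := by
  funext i
  exact SSet.stdSimplex.ext _ _ fun v ↦ congrFun (h v) i

/-- The simplex of the cube with given vertices. -/
def ofVert {n m : ℕ} (g : Fin (m + 1) → Fin n → Fin 2) (hg : Monotone g) :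
    (cube.{u} n) _⦋m⦌ :=
  fun i ↦ SSet.stdSimplex.objMk (n := ⦋1⦌) (m := op ⦋m⦌) ⟨fun v ↦ g v i, fun _ _ h ↦ hg h i⟩

lemma vert_map {n m l : ℕ} (f : ⦋l⦌ ⟶ ⦋m⦌) (x : (cube.{u} n) _⦋m⦌) (v : Fin (l + 1)) :
    vert ((cube n).map f.op x) v = vert x (f.toOrderHom v) := rfl

lemma vert_δ {n m : ℕ} (k : Fin (m + 2)) (x : (cube.{u} n) _⦋m + 1⦌) (v : Fin (m + 1)) :
    vert ((cube n).δ k x) v = vert x (k.succAbove v) := rfl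

lemma mem_ofSimplex_iff_vert {n m l : ℕ} (z : (cube.{u} n) _⦋m⦌) (y : (cube.{u} n) _⦋l⦌) :
    y ∈ (SSet.Subcomplex.ofSimplex z).obj (op ⦋l⦌) ↔
      ∃ f : Fin (l + 1) →o Fin (m + 1), ∀ v, vert y v = vert z (f v) := by
  rw [SSet.Subcomplex.mem_ofSimplex_obj_iff]
  constructor
  · rintro ⟨f, rfl⟩
    exact ⟨f.toOrderHom, fun v ↦ rfl⟩
  · rintro ⟨f, hf⟩
    exact ⟨SimplexCategory.Hom.mk f, cube_ext fun v ↦ (hf v).symm⟩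

lemma vert_strictMono {n m : ℕ} {z : (cube.{u} n) _⦋m⦌} (hz : Function.Injective (vert z)) :
    StrictMono (vert z) :=
  (vert_monotone z).strictMono_of_injective hz

/-- A simplex whose vertices are vertices of a nondegenerate simplex `z` is of the form `f^* z`:
the vertices of `z` form a chain, of which they are a monotone parametrization. -/
lemma mem_ofSimplex_of_vert_mem_range {n m l : ℕ} {z : (cube.{u} n) _⦋m⦌}
    (hz : Function.Injective (vert z)) {y : (cube.{u} n) _⦋l⦌}
    (hy : ∀ v, ∃ w, vert z w = vert y v) :
    y ∈ (SSet.Subcomplex.ofSimplex z).obj (op ⦋l⦌) := by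
  choose f hf using hy
  rw [mem_ofSimplex_iff_vert]
  refine ⟨⟨f, fun a b hab ↦ ?_⟩, fun v ↦ (hf v).symm⟩
  rw [← (vert_strictMono hz).le_iff_le, hf, hf]
  exact vert_monotone y hab

/-- A simplex that is not injective on vertices lies in every subcomplex that contains
its faces. -/
lemma mem_of_not_injective_vert {n m : ℕ} (U : (cube.{u} n).Subcomplex) (x : (cube.{u} n) _⦋m + 1⦌)
    (hx : ¬ Function.Injective (vert x)) (hU : ∀ k, (cube n).δ k x ∈ U.obj (op ⦋m⦌)) :
    x ∈ U.obj (op ⦋m + 1⦌) := by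
  obtain ⟨k, hk⟩ : ∃ k : Fin (m + 1), vert x k.castSucc = vert x k.succ := by
    by_contra! h
    exact hx (Fin.strictMono_iff_lt_succ.2 fun k ↦
      lt_of_le_of_ne (vert_monotone x (Fin.castSucc_lt_succ (i := k)).le) (h k)).injective
  have h : x = (cube n).σ k ((cube n).δ k.succ x) := by
    refine cube_ext fun v ↦ ?_
    change vert x v = vert x (k.succ.succAbove (k.predAbove v))
    rcases le_or_gt v k.castSucc with h | h
    · rw [Fin.predAbove_of_le_castSucc _ _ h, Fin.succAbove_of_castSucc_lt, Fin.castSucc_castPred]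
      simpa using lt_of_le_of_lt h (Fin.castSucc_lt_succ (i := k))
    · rw [Fin.predAbove_of_castSucc_lt _ _ h]
      rcases eq_or_ne v k.succ with rfl | h'
      · rw [Fin.pred_succ, Fin.succAbove_of_castSucc_lt _ _ Fin.castSucc_lt_succ, hk]
      · rw [Fin.succAbove_of_le_castSucc, Fin.succ_pred]
        have h1 : k.succ < v := lt_of_le_of_ne (Fin.castSucc_lt_iff_succ_le.1 h) (Ne.symm h')
        rw [Fin.le_def]
        simp only [Fin.lt_def, Fin.val_succ, Fin.val_castSucc, Fin.val_pred] at h1 ⊢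
        omega
  rw [h]
  exact U.map (SimplexCategory.σ k).op (hU _)

/-- There are finitely many subcomplexes because a subcomplex is determined by its nondegenerate
simplices. -/
lemma finite_subcomplex (X : SSet.{u}) [X.Finite] : Finite X.Subcomplex := by
  refine Finite.of_injective (fun (U : X.Subcomplex) ↦ ({s | s.simplex ∈ U.obj _} : Set X.N)) ?_
  have key (U V : X.Subcomplex)
      (h : ({s | s.simplex ∈ U.obj _} : Set X.N) = {s | s.simplex ∈ V.obj _}) : U ≤ V := by
    rw [SSet.Subcomplex.le_iff_contains_nonDegenerate]
    intro m x hx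
    have : SSet.N.mk x.1 x.2 ∈ ({s | s.simplex ∈ U.obj _} : Set X.N) := hx
    rw [h] at this
    exact this
  exact fun U V h ↦ le_antisymm (key U V h) (key V U h.symm)

/-- If the faces of `z` other than the `k`-th one lie in `U`, and the `k`-th one does not,
then the preimage of `U` along `z` is the horn. -/
lemma preimage_eq_horn {X : SSet.{u}} {m : ℕ} (U : X.Subcomplex) (z : X _⦋m + 1⦌)
    (k : Fin (m + 2)) (h : ∀ j, X.δ j z ∈ U.obj (op ⦋m⦌) ↔ j ≠ k) :
    U.preimage (SSet.yonedaEquiv.symm z) = SSet.horn (m + 1) k := by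
  have key (j : Fin (m + 2)) :
      SSet.stdSimplex.face {j}ᶜ ≤ U.preimage (SSet.yonedaEquiv.symm z) ↔ j ≠ k := by
    rw [← h j, ← SSet.stdSimplex.ofSimplex_yonedaEquiv_δ, SSet.Subcomplex.ofSimplex_le_iff]
    rfl
  refine le_antisymm ?_ ?_
  · rw [SSet.subcomplex_le_horn_iff, key]
    simp
  · rw [SSet.horn_eq_iSup]
    exact iSup_le fun j ↦ (key j).2 j.2

/-- The filling lemma. Let `A ≤ B` be subcomplexes of the cube, and `p` a vertex of `A`. Suppose
that each simplex of `B` that is not in `A` is the face opposite to a vertex `p` of a simplex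
of `B`, and that a simplex of `B` with vertex `p` lies in `A` as soon as the
face opposite to `p` does. Then `B` arises from `A` by successively filling horns `Λᵐ⁺¹ₖ`
along simplices with `k`-th vertex `p`. -/
theorem cone_induction {n : ℕ} [(cube.{u} n).Finite] {A B : (cube.{u} n).Subcomplex}
    (hAB : A ≤ B) (p : Fin n → Fin 2)
    (hp : ∀ x : (cube.{u} n) _⦋0⦌, vert x 0 = p → x ∈ A.obj (op ⦋0⦌))
    (exists_cone : ∀ (m : ℕ) (x : (cube.{u} n) _⦋m⦌), x ∈ B.obj (op ⦋m⦌) → x ∉ A.obj (op ⦋m⦌) →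
      ∃ (z : (cube.{u} n) _⦋m + 1⦌) (k : Fin (m + 2)),
        z ∈ B.obj (op ⦋m + 1⦌) ∧ (cube n).δ k z = x ∧ vert z k = p)
    (mem_of_face : ∀ (m : ℕ) (z : (cube.{u} n) _⦋m + 1⦌) (k : Fin (m + 2)),
      z ∈ B.obj (op ⦋m + 1⦌) → vert z k = p → (cube n).δ k z ∈ A.obj (op ⦋m⦌) →
        z ∈ A.obj (op ⦋m + 1⦌))
    {P : (cube.{u} n).Subcomplex → Prop} (hA : P A)
    (attach : ∀ (U : (cube.{u} n).Subcomplex) (m : ℕ) (z : (cube.{u} n) _⦋m + 1⦌)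
      (k : Fin (m + 2)), A ≤ U → U ≤ B → P U → z ∈ B.obj (op ⦋m + 1⦌) → vert z k = p →
      (cube n).δ k z ∉ A.obj (op ⦋m⦌) → Function.Injective (vert z) →
      U.preimage (SSet.yonedaEquiv.symm z) = SSet.horn (m + 1) k →
      P (U ⊔ SSet.Subcomplex.ofSimplex z)) : P B := by
  have := finite_subcomplex (cube.{u} n)
  -- a maximal intermediate complex that is closed under adding the vertex `p`
  obtain ⟨U, ⟨hAU, hUB, hPU, hclosed⟩, hmax⟩ := (Set.toFinite ({U |
    A ≤ U ∧ U ≤ B ∧ P U ∧ ∀ (m : ℕ) (z : (cube.{u} n) _⦋m + 1⦌) (k : Fin (m + 2)),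
      z ∈ B.obj (op ⦋m + 1⦌) → vert z k = p → (cube n).δ k z ∈ U.obj (op ⦋m⦌) →
        z ∈ U.obj (op ⦋m + 1⦌)} :
        Set (cube.{u} n).Subcomplex)).exists_maximal ⟨A, le_rfl, hAB, hA, mem_of_face⟩
  suffices h : B ≤ U by rwa [← le_antisymm hUB h]
  by_contra hBU
  have hex : ∃ (m : ℕ) (x : (cube.{u} n) _⦋m⦌), x ∈ B.obj (op ⦋m⦌) ∧ x ∉ U.obj (op ⦋m⦌) := by
    by_contra! h
    refine hBU ?_
    rintro ⟨k⟩ x hx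
    induction k using SimplexCategory.rec with | _ k
    exact h k x hx
  classical
  obtain ⟨m, ⟨x, hxB, hxU⟩, hmin⟩ : ∃ m, (∃ x : (cube.{u} n) _⦋m⦌,
      x ∈ B.obj (op ⦋m⦌) ∧ x ∉ U.obj (op ⦋m⦌)) ∧ ∀ l < m, ∀ y : (cube.{u} n) _⦋l⦌,
        y ∈ B.obj (op ⦋l⦌) → y ∈ U.obj (op ⦋l⦌) := by
    refine ⟨Nat.find hex, Nat.find_spec hex, fun l hl y hy ↦ ?_⟩
    by_contra hyU
    exact Nat.find_min hex hl ⟨y, hy, hyU⟩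
  have hxp : ∀ v, vert x v ≠ p := by
    intro v hv
    cases m with
    | zero =>
      obtain rfl : v = 0 := Fin.eq_zero v
      exact hxU (hAU _ (hp x hv))
    | succ m =>
      exact hxU (hclosed m x v hxB hv
        (hmin m (Nat.lt_succ_self m) _ (B.map (SimplexCategory.δ v).op hxB)))
  have hxinj : Function.Injective (vert x) := by
    cases m with
    | zero => exact fun a b _ ↦ (Fin.eq_zero a).trans (Fin.eq_zero b).symm
    | succ m =>
      by_contra h
      exact hxU (mem_of_not_injective_vert U x h fun k ↦
        hmin m (Nat.lt_succ_self m) _ (B.map (SimplexCategory.δ k).op hxB))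
  obtain ⟨z, k, hzB, hzx, hzk⟩ := exists_cone m x hxB (fun h ↦ hxU (hAU _ h))
  have hzv (v : Fin (m + 1)) : vert z (k.succAbove v) = vert x v := by rw [← hzx]; rfl
  have hzinj : Function.Injective (vert z) := by
    intro a b hab
    rcases Fin.eq_self_or_eq_succAbove k a with ha | ⟨a, rfl⟩ <;>
      rcases Fin.eq_self_or_eq_succAbove k b with hb | ⟨b, rfl⟩
    · exact ha.trans hb.symm
    · rw [ha, hzk, hzv] at hab
      exact (hxp b hab.symm).elim
    · rw [hb, hzk, hzv] at hab
      exact (hxp a hab).elim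
    · rw [hzv, hzv] at hab
      rw [hxinj hab]
  have hhorn : U.preimage (SSet.yonedaEquiv.symm z) = SSet.horn (m + 1) k := by
    refine preimage_eq_horn U z k fun j ↦ ⟨?_, fun hj ↦ ?_⟩
    · rintro h rfl
      exact hxU (hzx ▸ h)
    · obtain ⟨i, hi⟩ := Fin.exists_succAbove_eq (Ne.symm hj)
      have hB := B.map (SimplexCategory.δ j).op hzB
      have hip : vert ((cube n).δ j z) i = p := by rw [vert_δ, hi, hzk]
      cases m with
      | zero =>
        obtain rfl : i = 0 := Fin.eq_zero i
        exact hAU _ (hp _ hip)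
      | succ m =>
        refine hclosed m _ i hB hip (hmin m (Nat.lt_succ_self m) _ ?_)
        exact B.map (SimplexCategory.δ i).op hB
  -- adjoining `z` gives a larger complex with the same properties
  have hV : U ⊔ SSet.Subcomplex.ofSimplex z ≤ U := by
    refine hmax ⟨hAU.trans le_sup_left, sup_le hUB ?_, ?_, ?_⟩ le_sup_left
    · rwa [SSet.Subcomplex.ofSimplex_le_iff]
    · exact attach U m z k hAU hUB hPU hzB hzk (fun h ↦ hxU (hAU _ (hzx ▸ h))) hzinj hhorn
    · rintro l y i hyB hyi (hy | hy)
      · exact Or.inl (hclosed l y i hyB hyi hy)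
      · refine Or.inr (mem_ofSimplex_of_vert_mem_range hzinj fun v ↦ ?_)
        rcases Fin.eq_self_or_eq_succAbove i v with rfl | ⟨v, rfl⟩
        · exact ⟨k, by rw [hzk, hyi]⟩
        · obtain ⟨f, hf⟩ := (mem_ofSimplex_iff_vert z _).1 hy
          exact ⟨f v, (hf v).symm⟩
  refine hxU (hV _ (Or.inr ?_))
  rw [← hzx]
  exact (SSet.Subcomplex.ofSimplex z).map (SimplexCategory.δ k).op
    (SSet.Subcomplex.mem_ofSimplex_obj z)

/-! ### Maximal chains, the filtration and the subcomplex `J` -/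

lemma vert_permSimplex {n : ℕ} (τ : Equiv.Perm (Fin n)) (v : Fin (n + 1)) (i : Fin n) :
    vert (permSimplex.{u} τ) v i = if (τ i).val < v.val then 1 else 0 := by
  have h : vert (permSimplex.{u} τ) v i =
      if v.castSucc < (τ i).succ.castSucc then 0 else 1 :=
    SSet.stdSimplex.objMk₁_apply _ _
  have h' : v.castSucc < (τ i).succ.castSucc ↔ ¬ (τ i).val < v.val := by
    rw [Fin.castSucc_lt_castSucc_iff, Fin.lt_def, Fin.val_succ]
    omega
  rw [h, if_congr h' rfl rfl, ite_not]

lemma vert_permSimplex_injective {n : ℕ} (τ : Equiv.Perm (Fin n)) :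
    Function.Injective (vert (permSimplex.{u} τ)) := by
  have key (v w : Fin (n + 1)) (h : v < w) :
      vert (permSimplex.{u} τ) v ≠ vert (permSimplex.{u} τ) w := by
    intro e
    have hv : v.val < n := by have := w.isLt; rw [Fin.lt_def] at h; omega
    have := congrFun e (τ.symm ⟨v, hv⟩)
    simp [vert_permSimplex, Fin.lt_def.1 h] at this
  intro v w h
  by_contra hne
  rcases lt_or_gt_of_ne hne with h' | h'
  · exact key v w h' h
  · exact key w v h' h.symm

/-- A lower set in `Fin n` consists of the first elements of `Fin n`. -/
lemma mem_iff_val_lt_card {n : ℕ} {S : Finset (Fin n)} (hS : ∀ i j, i ≤ j → j ∈ S → i ∈ S)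
    (j : Fin n) : j ∈ S ↔ j.val < S.card := by
  constructor
  · intro hj
    have := Finset.card_le_card (fun i hi ↦ hS i j (Finset.mem_Iic.1 hi) hj : Finset.Iic j ⊆ S)
    rw [Fin.card_Iic] at this
    omega
  · intro hj
    by_contra h
    have : S ⊆ Finset.Iio j := fun i hi ↦ Finset.mem_Iio.2 (by
      by_contra h'
      exact h (hS j i (not_lt.1 h') hi))
    have := Finset.card_le_card this
    rw [Fin.card_Iio] at this
    omega

lemma fin_two_eq_one_of_le {a b : Fin 2} (h : a ≤ b) (ha : a = 1) : b = 1 := by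
  omega

/-- A simplex of the cube is of the form `f^* φ(τ)` if and only if `τ` lists the coordinates
in decreasing order, that is, in the order in which they jump to `1`. -/
lemma mem_ofSimplex_permSimplex_iff {n m : ℕ} (τ : Equiv.Perm (Fin n)) (x : (cube.{u} n) _⦋m⦌) :
    x ∈ (SSet.Subcomplex.ofSimplex (permSimplex τ)).obj (op ⦋m⦌) ↔
      ∀ i j, τ i ≤ τ j → ∀ v, vert x v j ≤ vert x v i := by
  rw [mem_ofSimplex_iff_vert]
  constructor
  · rintro ⟨f, hf⟩ i j hij v
    rw [hf, vert_permSimplex, vert_permSimplex]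
    rw [Fin.le_def] at hij
    split_ifs <;> omega
  · intro h
    let S (v : Fin (m + 1)) : Finset (Fin n) := {k | vert x v (τ.symm k) = 1}
    have hS (v : Fin (m + 1)) (i : Fin n) : vert x v i = 1 ↔ (τ i).val < (S v).card := by
      rw [← mem_iff_val_lt_card (fun a b hab hb ↦ ?_)]
      · simp [S]
      · simp only [S, Finset.mem_filter, Finset.mem_univ, true_and] at hb ⊢
        exact fin_two_eq_one_of_le (h _ _ (by simpa using hab) v) hb
    refine ⟨⟨fun v ↦ ⟨(S v).card, ?_⟩, fun v w hvw ↦ ?_⟩, fun v ↦ ?_⟩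
    · exact Nat.lt_succ_of_le ((Finset.card_le_univ _).trans (by simp))
    · refine Fin.mk_le_mk.2 (Finset.card_le_card fun k hk ↦ ?_)
      simp only [S, Finset.mem_filter, Finset.mem_univ, true_and] at hk ⊢
      exact fin_two_eq_one_of_le (vert_monotone x hvw _) hk
    · funext i
      rw [vert_permSimplex]
      have := hS v i
      change _ = if (τ i).val < (S v).card then 1 else 0
      split_ifs with h'
      · exact this.2 h'
      · have h0 := mt this.1 h'
        omega

/-- Every simplex of the cube is a face or degeneracy of some `φ(τ)`; the permutation can be
chosen such that it lists a coordinate before each larger coordinate that it dominates. -/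
lemma exists_mem_ofSimplex_permSimplex {n m : ℕ} (x : (cube.{u} n) _⦋m⦌) :
    ∃ τ : Equiv.Perm (Fin n), x ∈ (SSet.Subcomplex.ofSimplex (permSimplex τ)).obj (op ⦋m⦌) ∧
      ∀ i j, (∀ v, vert x v j ≤ vert x v i) → i < j → τ i < τ j := by
  have ht (i : Fin n) : ∃ t : Fin (m + 2), SSet.stdSimplex.objMk₁ t = x i :=
    SSet.stdSimplex.objMk₁_surjective _
  choose t ht using ht
  have hv (v : Fin (m + 1)) (i : Fin n) : vert x v i = if v.castSucc < t i then 0 else 1 := by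
    unfold vert
    rw [← ht]
    exact SSet.stdSimplex.objMk₁_apply _ _
  -- sort the coordinates by the vertex `t i` at which they jump to `1`, ties in the natural order
  let key (i : Fin n) : Fin (m + 2) ×ₗ Fin n := toLex (t i, i)
  have hw := Tuple.monotone_sort key
  refine ⟨(Tuple.sort key).symm, ?_, fun i j hij hlt ↦ ?_⟩
  · rw [mem_ofSimplex_permSimplex_iff]
    intro i j hij v
    have h1 := hw hij
    simp only [Function.comp, Equiv.apply_symm_apply, key, Prod.Lex.toLex_le_toLex] at h1
    have h2 : t i ≤ t j := by
      rcases h1 with h | h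
      · exact h.le
      · exact h.1.le
    rw [hv, hv]
    split_ifs with h3 h4
    · exact le_rfl
    · simp
    · exact absurd (lt_of_lt_of_le ‹_› h2) h3
    · exact le_rfl
  · by_contra h
    have h1 := hw (not_lt.1 h)
    simp only [Function.comp, Equiv.apply_symm_apply, key, Prod.Lex.toLex_le_toLex] at h1
    rcases h1 with h1 | h1
    · have hlt' : (t j).val < m + 1 := by have := (t i).isLt; rw [Fin.lt_def] at h1; omega
      have := hij ⟨t j, hlt'⟩
      rw [hv, hv, if_neg, if_pos] at this
      · exact absurd this (by decide)
      · exact h1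
      · exact lt_irrefl _
    · exact absurd h1.2 (not_le.2 hlt)

instance (n : ℕ) : (cube.{u} n).Finite := by
  have h : (⨆ τ : Equiv.Perm (Fin n), SSet.Subcomplex.ofSimplex (permSimplex.{u} τ)) = ⊤ := by
    rw [eq_top_iff]
    rintro ⟨k⟩ x -
    induction k using SimplexCategory.rec with | _ k
    obtain ⟨τ, hτ, -⟩ := exists_mem_ofSimplex_permSimplex x
    simp only [Subfunctor.iSup_obj, Set.mem_iUnion]
    exact ⟨τ, hτ⟩
  rw [← SSet.finite_subcomplex_top_iff, ← h, SSet.finite_iSup_iff]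
  infer_instance

lemma mem_cubeFace_iff {n m : ℕ} (i : Fin n) (j : Fin 2) (x : (cube.{u} n) _⦋m⦌) :
    x ∈ (cubeFace n i j).obj (op ⦋m⦌) ↔ ∀ v, vert x v i = j := by
  constructor
  · intro h v
    change x i = _ at h
    unfold vert
    rw [h]
    rfl
  · intro h
    change x i = _
    exact SSet.stdSimplex.ext _ _ h

lemma mem_cubeBoundary_iff {n m : ℕ} (x : (cube.{u} n) _⦋m⦌) :
    x ∈ (cubeBoundary n).obj (op ⦋m⦌) ↔ ∃ i j, ∀ v, vert x v i = j := by
  simp only [cubeBoundary, Subfunctor.iSup_obj, Set.mem_iUnion, mem_cubeFace_iff]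

lemma mem_leftBox_iff {n m : ℕ} (x : (cube.{u} (n + 1)) _⦋m⦌) :
    x ∈ (leftBox n).obj (op ⦋m⦌) ↔
      ∃ i j, (i ≠ Fin.last n ∨ j = 0) ∧ ∀ v, vert x v i = j := by
  simp only [leftBox, Subfunctor.iSup_obj, Set.mem_iUnion, mem_cubeFace_iff, Prod.exists,
    exists_prop, ne_eq, Prod.mk.injEq, not_and_or]
  refine exists_congr fun i ↦ exists_congr fun j ↦ and_congr_left fun _ ↦ or_congr_right ?_
  omega

lemma mem_cubeFiltration_iff {n m : ℕ} (τ : Equiv.Perm (Fin (n + 1)))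
    (x : (cube.{u} (n + 1)) _⦋m⦌) :
    x ∈ (cubeFiltration n τ).obj (op ⦋m⦌) ↔ x ∈ (leftBox n).obj (op ⦋m⦌) ∨
      ∃ τ', PermLT τ' τ ∧ x ∈ (SSet.Subcomplex.ofSimplex (permSimplex τ')).obj (op ⦋m⦌) := by
  simp only [cubeFiltration, Subfunctor.max_obj, Subfunctor.iSup_obj, Set.mem_union,
    Set.mem_iUnion, exists_prop]

lemma permLT_finRotate_iff {n : ℕ} (τ : Equiv.Perm (Fin (n + 1))) :
    PermLT τ (finRotate (n + 1)) ↔ τ.symm 0 ≠ Fin.last n := by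
  have h0 : (finRotate (n + 1)).symm 0 = Fin.last n := by
    rw [Equiv.symm_apply_eq, finRotate_last]
  have hs (k : Fin n) : (finRotate (n + 1)).symm k.succ = k.castSucc := by
    rw [Equiv.symm_apply_eq, finRotate_apply, Fin.coeSucc_eq_succ]
  constructor
  · rintro ⟨k, hk, hlt⟩ h
    induction k using Fin.cases with
    | zero =>
      rw [h, h0] at hlt
      exact lt_irrefl _ hlt
    | succ k =>
      rw [hs] at hlt
      obtain ⟨j, hj⟩ := Fin.exists_castSucc_eq.2
        (Fin.ne_last_of_lt (hlt : τ.symm k.succ < k.castSucc))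
      rw [← hj, Fin.castSucc_lt_castSucc_iff] at hlt
      have h1 := hk j.succ (Fin.succ_lt_succ_iff.2 hlt)
      rw [hs, hj] at h1
      have h2 := τ.symm.injective h1
      rw [Fin.succ_inj] at h2
      exact absurd h2 hlt.ne
  · intro h
    refine ⟨0, fun i hi ↦ absurd hi (Fin.not_lt_zero i), ?_⟩
    rw [h0]
    exact Fin.lt_last_iff_ne_last.2 h

/-- The filtration at the permutation `(2, …, n + 1, 1)`: a simplex that is not in the left
box belongs to it if and only if some coordinate other than the last one dominates the
last one. -/
lemma mem_cubeFiltration_finRotate_iff {n m : ℕ} (x : (cube.{u} (n + 1)) _⦋m⦌) :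
    x ∈ (cubeFiltration n (finRotate (n + 1))).obj (op ⦋m⦌) ↔ x ∈ (leftBox n).obj (op ⦋m⦌) ∨
      ∃ i ≠ Fin.last n, ∀ v, vert x v (Fin.last n) ≤ vert x v i := by
  rw [mem_cubeFiltration_iff]
  refine or_congr_right ⟨?_, ?_⟩
  · rintro ⟨τ, hτ, hx⟩
    rw [permLT_finRotate_iff] at hτ
    rw [mem_ofSimplex_permSimplex_iff] at hx
    exact ⟨_, hτ, hx _ _ (by simp)⟩
  · rintro ⟨i, hi, hx⟩
    obtain ⟨τ, hτ, h⟩ := exists_mem_ofSimplex_permSimplex x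
    refine ⟨τ, ?_, hτ⟩
    rw [permLT_finRotate_iff]
    intro h0
    have := h i _ hx (Fin.lt_last_iff_ne_last.2 hi)
    rw [← h0, Equiv.apply_symm_apply] at this
    exact Fin.not_lt_zero _ this

lemma spineBeginsLast_permSimplex_iff {n : ℕ} (τ : Equiv.Perm (Fin (n + 1))) :
    SpineBeginsLast (permSimplex.{u} τ) ↔ τ.symm 0 = Fin.last n := by
  have h : SpineBeginsLast (permSimplex.{u} τ) ↔ ∀ i, vert (permSimplex.{u} τ) 0 i = 0 ∧
    vert (permSimplex.{u} τ) 1 i = if i = Fin.last n then 1 else 0 := Iff.rfl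
  have h0 (i : Fin (n + 1)) : vert (permSimplex.{u} τ) 0 i = 0 := by
    rw [vert_permSimplex, if_neg (by rw [Fin.val_zero]; omega)]
  have h1 (i : Fin (n + 1)) : vert (permSimplex.{u} τ) 1 i = if τ i = 0 then 1 else 0 := by
    have : (τ i).val < (1 : Fin (n + 2)).val ↔ τ i = 0 := by
      rw [Fin.val_one, Nat.lt_one_iff, Fin.val_eq_zero_iff]
    rw [vert_permSimplex, if_congr this rfl rfl]
  rw [h, Equiv.symm_apply_eq]
  simp only [h0, h1, true_and]
  constructor
  · intro h
    have := h (Fin.last n)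
    by_contra h'
    rw [if_pos rfl, if_neg (Ne.symm h')] at this
    exact absurd this (by decide)
  · intro h i
    exact if_congr (by rw [h, τ.injective.eq_iff]) rfl rfl

lemma permSimplex_mem_nonDegenerate {n : ℕ} (τ : Equiv.Perm (Fin n)) :
    permSimplex.{u} τ ∈ (cube n).nonDegenerate n := by
  rw [SSet.mem_nonDegenerate_iff_notMem_degenerate, SSet.mem_degenerate_iff]
  rintro ⟨m, hm, f, -, y, hy⟩
  have : Function.Injective f.toOrderHom := by
    intro a b hab
    apply vert_permSimplex_injective.{u} τ
    rw [← hy, vert_map, vert_map, hab]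
  have := Fintype.card_le_of_injective _ this
  simp at this
  omega

lemma exists_eq_permSimplex {n : ℕ} {σ : (cube.{u} n) _⦋n⦌} (h : σ ∈ (cube n).nonDegenerate n) :
    ∃ τ, σ = permSimplex τ := by
  obtain ⟨τ, hτ, -⟩ := exists_mem_ofSimplex_permSimplex σ
  rw [SSet.Subcomplex.mem_ofSimplex_obj_iff] at hτ
  obtain ⟨f, hf⟩ := hτ
  have : Mono f := (cube n).mono_of_nonDegenerate ⟨σ, h⟩ f _ hf
  obtain rfl := SimplexCategory.eq_id_of_mono f
  exact ⟨τ, by simpa using hf.symm⟩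

theorem cubeJ_eq_cubeFiltration (n : ℕ) :
    cubeJ.{u} n = cubeFiltration n (finRotate (n + 1)) := by
  refine congrArg (leftBox n ⊔ ·) (le_antisymm ?_ ?_)
  · refine iSup₂_le fun σ hσ ↦ ?_
    obtain ⟨τ, rfl⟩ := exists_eq_permSimplex hσ.1
    have := hσ.2
    rw [spineBeginsLast_permSimplex_iff] at this
    exact le_iSup₂_of_le τ ((permLT_finRotate_iff τ).2 this) le_rfl
  · refine iSup₂_le fun τ hτ ↦ ?_
    refine le_iSup₂_of_le (permSimplex τ) ⟨permSimplex_mem_nonDegenerate τ, ?_⟩ le_rfl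
    rwa [spineBeginsLast_permSimplex_iff, ← ne_eq, ← permLT_finRotate_iff]

lemma mem_cubeJ_iff {n m : ℕ} (x : (cube.{u} (n + 1)) _⦋m⦌) :
    x ∈ (cubeJ n).obj (op ⦋m⦌) ↔ x ∈ (leftBox n).obj (op ⦋m⦌) ∨
      ∃ i ≠ Fin.last n, ∀ v, vert x v (Fin.last n) ≤ vert x v i := by
  rw [cubeJ_eq_cubeFiltration, mem_cubeFiltration_finRotate_iff]

/-! ### Attaching simplices along horns -/

/-- A commutative square of simplicial sets with monic left, right and bottom maps is a pushout
square if the images of the right and bottom maps cover the target and meet in the image of the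
upper left corner. -/
lemma isPushout_of_mono {A B C D : SSet.{u}} {t : A ⟶ B} {l : A ⟶ C} {r : B ⟶ D} {b : C ⟶ D}
    [Mono l] [Mono r] [Mono b] (w : t ≫ r = l ≫ b)
    (inter : ∀ (m : ℕ) (x : B _⦋m⦌) (y : C _⦋m⦌), r.app _ x = b.app _ y →
      y ∈ Set.range (l.app (op ⦋m⦌)))
    (cover : ∀ (m : ℕ) (z : D _⦋m⦌),
      z ∈ Set.range (r.app (op ⦋m⦌)) ∨ z ∈ Set.range (b.app (op ⦋m⦌))) :
    IsPushout t l r b where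
  w := w
  isColimit' := ⟨evaluationJointlyReflectsColimits _ (fun ⟨⟨m⟩⟩ ↦ by
    have inj {X Y : SSet.{u}} (f : X ⟶ Y) [Mono f] : Function.Injective (f.app (op ⦋m⦌)) :=
      injective_of_mono (f.app (op ⦋m⦌))
    have w' (x : A _⦋m⦌) : r.app _ (t.app _ x) = b.app _ (l.app _ x) :=
      congrArg (fun (f : A ⟶ D) ↦ f.app (op ⦋m⦌) x) w
    refine (isColimitMapCoconePushoutCoconeEquiv _ _).symm (IsPushout.isColimit ?_)
    refine Types.isPushout_of_isPullback_of_mono' ?_ ?_ (fun _ _ _ _ h ↦ inj b h)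
    · rw [Types.isPullback_iff]
      refine ⟨congr_app w (op ⦋m⦌), fun _ _ h ↦ inj l h.2, fun x y h ↦ ?_⟩
      obtain ⟨a, rfl⟩ := inter m x y h
      exact ⟨a, inj r ((w' a).trans h.symm), rfl⟩
    · exact Set.eq_univ_of_forall (cover m))⟩

lemma mono_yonedaEquiv_symm {n m : ℕ} {z : (cube.{u} n) _⦋m⦌}
    (hz : Function.Injective (vert z)) : Mono (SSet.yonedaEquiv.symm z) := by
  rw [NatTrans.mono_iff_mono_app]
  rintro ⟨⟨l⟩⟩
  rw [mono_iff_injective]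
  intro (y : Δ[m] _⦋l⦌) y' h
  refine SSet.stdSimplex.ext _ _ fun v ↦ hz ?_
  exact congrArg (fun x : (cube.{u} n) _⦋l⦌ ↦ vert x v) h

section Attach

variable {X : SSet.{u}} {m : ℕ} {U : X.Subcomplex} {z : X _⦋m + 1⦌} {k : Fin (m + 2)}
  (h : U.preimage (SSet.yonedaEquiv.symm z) = SSet.horn (m + 1) k)

/-- The map to `U` from the horn of a simplex that meets `U` in that horn. -/
def hornToSubcomplex : (Λ[m + 1, k] : SSet.{u}) ⟶ U :=
  SSet.Subcomplex.lift ((SSet.horn (m + 1) k).ι ≫ SSet.yonedaEquiv.symm z) (by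
    rintro l _ ⟨y, rfl⟩
    exact h.ge l y.2)

variable (U z) in
/-- The simplex `z`, as a map to the subcomplex obtained by adjoining `z` to `U`. -/
def simplexToSup : Δ[m + 1] ⟶ (U ⊔ SSet.Subcomplex.ofSimplex z : X.Subcomplex) :=
  SSet.Subcomplex.lift (SSet.yonedaEquiv.symm z) (by
    rw [SSet.Subcomplex.range_eq_ofSimplex, Equiv.apply_symm_apply]
    exact le_sup_right)

/-- If the nondegenerate simplex `z` meets `U` in a horn, then adjoining `z` to `U` is a
pushout of the horn inclusion. -/
lemma isPushout_attach (hz : Mono (SSet.yonedaEquiv.symm z)) :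
    IsPushout (hornToSubcomplex h) (SSet.horn (m + 1) k).ι
      (SSet.Subcomplex.homOfLE (le_sup_left : U ≤ U ⊔ SSet.Subcomplex.ofSimplex z))
      (simplexToSup U z) := by
  have : Mono (simplexToSup U z) :=
    mono_of_mono_fac (SSet.Subcomplex.lift_ι (SSet.yonedaEquiv.symm z) _)
  refine isPushout_of_mono rfl (fun l x y hxy ↦ ?_) (fun l y ↦ ?_)
  · have hy : y ∈ (SSet.horn (m + 1) k).obj (op ⦋l⦌) := by
      rw [← h]
      have := congrArg Subtype.val hxy
      change (SSet.yonedaEquiv.symm z).app _ y ∈ U.obj _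
      change x.1 = (SSet.yonedaEquiv.symm z).app _ y at this
      rw [← this]
      exact x.2
    exact ⟨⟨y, hy⟩, rfl⟩
  · obtain ⟨y, hy | hy⟩ := y
    · exact Or.inl ⟨⟨y, hy⟩, rfl⟩
    · obtain ⟨f, rfl⟩ := (SSet.Subcomplex.mem_ofSimplex_obj_iff _ _).1 hy
      exact Or.inr ⟨SSet.stdSimplex.objEquiv.symm f, rfl⟩

end Attach

/-- The vertex `s` of `φ(τ)` is a descent if the coordinate that jumps to `1` just after `s` is
smaller than the one that jumps just before `s`. Exchanging the two then yields a smaller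
permutation, whose simplex differs from `φ(τ)` only in the vertex `s`. -/
def IsDescent {n : ℕ} (τ : Equiv.Perm (Fin (n + 1))) (s : Fin (n + 2)) : Prop :=
  ∃ k : Fin n, s = k.succ.castSucc ∧ τ.symm k.succ < τ.symm k.castSucc

/-- A simplex of `φ(τ)` that omits the vertex `k + 1` also lies in the simplex of the permutation
in which the coordinates that jump just before and just after this vertex are exchanged. -/
lemma mem_ofSimplex_of_not_mem_range {n m : ℕ} (τ : Equiv.Perm (Fin (n + 1)))
    {x : (cube.{u} (n + 1)) _⦋m⦌} (f : Fin (m + 1) →o Fin (n + 2))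
    (hx : ∀ v, vert x v = vert (permSimplex τ) (f v)) (k : Fin n)
    (hk : ∀ v, f v ≠ k.succ.castSucc) :
    x ∈ (SSet.Subcomplex.ofSimplex (permSimplex
      (τ.trans (Equiv.swap k.castSucc k.succ)))).obj (op ⦋m⦌) := by
  rw [mem_ofSimplex_iff_vert]
  refine ⟨f, fun v ↦ ?_⟩
  rw [hx]
  funext i
  rw [vert_permSimplex, vert_permSimplex]
  refine if_congr ?_ rfl rfl
  have := hk v
  rw [ne_eq, Fin.ext_iff, Fin.val_castSucc, Fin.val_succ] at this
  rw [Equiv.trans_apply, Equiv.swap_apply_def]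
  split_ifs with h1 h2
  · rw [h1, Fin.val_succ, Fin.val_castSucc]
    omega
  · rw [h2, Fin.val_succ, Fin.val_castSucc]
    omega
  · rfl

/-- The intersection of `φ(τ)` with the previous stage of the filtration is the union of the
faces opposite to the first vertex, to the last vertex, and to the descents: if a simplex
contains all these vertices, then `τ` is the smallest permutation with this simplex in `φ(τ)`. -/
lemma mem_cubeFiltration_iff_exists_not_mem_range {n m : ℕ} {τ : Equiv.Perm (Fin (n + 1))}
    (hτ : τ.symm 0 ≠ Fin.last n) {x : (cube.{u} (n + 1)) _⦋m⦌} (f : Fin (m + 1) →o Fin (n + 2))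
    (hx : ∀ v, vert x v = vert (permSimplex τ) (f v)) :
    x ∈ (cubeFiltration n τ).obj (op ⦋m⦌) ↔
      ∃ s, (s = 0 ∨ s = Fin.last (n + 1) ∨ IsDescent τ s) ∧ ∀ v, f v ≠ s := by
  have hx' (v : Fin (m + 1)) (i : Fin (n + 1)) :
      vert x v i = if (τ i).val < (f v).val then 1 else 0 := by
    rw [hx, vert_permSimplex]
  rw [mem_cubeFiltration_iff]
  constructor
  · rintro (h | ⟨τ', ⟨k, hk, hlt⟩, h⟩)
    · rw [mem_leftBox_iff] at h
      obtain ⟨i, j, -, h⟩ := h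
      by_cases hj : j = 1
      · refine ⟨0, Or.inl rfl, fun v hv ↦ ?_⟩
        have := h v
        rw [hx', hj, hv, if_neg (by rw [Fin.val_zero]; omega)] at this
        exact absurd this (by decide)
      · refine ⟨Fin.last _, Or.inr (Or.inl rfl), fun v hv ↦ ?_⟩
        have := h v
        rw [hx', hv, if_pos (by rw [Fin.val_last]; omega)] at this
        exact hj this.symm
    · rw [mem_ofSimplex_permSimplex_iff] at h
      by_contra! hs
      -- the coordinate at position `k` of `τ'⁻¹` appears in `τ⁻¹` at a position after `k`
      have hsymm : τ (τ'.symm k) > k := by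
        by_contra hle
        rcases lt_or_eq_of_le (not_lt.1 hle) with h' | h'
        · have := hk _ h'
          rw [Equiv.symm_apply_apply, EmbeddingLike.apply_eq_iff_eq] at this
          exact absurd this h'.ne
        · have : τ'.symm k = τ.symm k := by rw [← h', Equiv.symm_apply_apply, h']
          exact absurd this hlt.ne
      -- no vertex of `x` lies strictly between these positions
      have hgap (v : Fin (m + 1)) : (f v).val ≤ k.val ∨ (τ (τ'.symm k)).val < (f v).val := by
        have := h (τ'.symm k) (τ.symm k) (by
          rw [Equiv.apply_symm_apply]
          by_contra hle
          have := hk _ (not_le.1 hle)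
          rw [Equiv.symm_apply_apply, EmbeddingLike.apply_eq_iff_eq] at this
          exact (not_le.1 hle).ne' this) v
        rw [hx', hx', Equiv.apply_symm_apply] at this
        split_ifs at this with h1 h2 h2
        · exact Or.inr h2
        · exact absurd this (by decide)
        · exact Or.inr h2
        · exact Or.inl (not_lt.1 h1)
      -- so there are no descents between them, and `τ⁻¹` increases from `k` to this position
      have hasc (l : ℕ) (hl : l < n + 1) : k.val < l → l ≤ (τ (τ'.symm k)).val →
          τ.symm k < τ.symm ⟨l, hl⟩ := by
        induction l with
        | zero => intro h; omega
        | succ l ih =>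
          intro h1 h2
          have hl' : l < n := by omega
          have hstep : τ.symm (⟨l, hl'⟩ : Fin n).castSucc < τ.symm (⟨l, hl'⟩ : Fin n).succ := by
            by_contra hle
            have hne : τ.symm (⟨l, hl'⟩ : Fin n).castSucc ≠ τ.symm (⟨l, hl'⟩ : Fin n).succ :=
              fun e ↦ (Fin.castSucc_lt_succ (i := (⟨l, hl'⟩ : Fin n))).ne (τ.symm.injective e)
            obtain ⟨v, hv⟩ := hs (⟨l, hl'⟩ : Fin n).succ.castSucc
              (Or.inr (Or.inr ⟨_, rfl, lt_of_le_of_ne (not_lt.1 hle) hne.symm⟩))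
            have := hgap v
            rw [hv, Fin.val_castSucc, Fin.val_succ] at this
            simp only at this
            omega
          rcases Nat.lt_or_eq_of_le (Nat.le_of_lt_succ h1) with h3 | h3
          · exact (ih (by omega) h3 (by omega)).trans hstep
          · have : k = (⟨l, hl'⟩ : Fin n).castSucc := Fin.ext h3
            rw [this]
            exact hstep
      have := hasc _ (τ (τ'.symm k)).isLt hsymm le_rfl
      simp only [Fin.eta, Equiv.symm_apply_apply] at this
      exact absurd hlt (not_lt.2 this.le)
  · rintro ⟨s, rfl | rfl | ⟨k, rfl, hlt⟩, hs⟩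
    · left
      rw [mem_leftBox_iff]
      refine ⟨τ.symm 0, 1, Or.inl hτ, fun v ↦ ?_⟩
      rw [hx', Equiv.apply_symm_apply, if_pos]
      exact Nat.pos_of_ne_zero fun h ↦ hs v (Fin.ext h)
    · left
      rw [mem_leftBox_iff]
      refine ⟨τ.symm (Fin.last n), 0, Or.inr rfl, fun v ↦ ?_⟩
      rw [hx', Equiv.apply_symm_apply, if_neg]
      have := hs v
      rw [ne_eq, Fin.ext_iff, Fin.val_last] at this
      rw [Fin.val_last]
      omega
    · right
      refine ⟨τ.trans (Equiv.swap k.castSucc k.succ), ⟨k.castSucc, fun i hi ↦ ?_, ?_⟩,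
        mem_ofSimplex_of_not_mem_range τ f hx k hs⟩
      · rw [Equiv.symm_trans_apply, Equiv.symm_swap, Equiv.swap_apply_of_ne_of_ne hi.ne
          (hi.trans Fin.castSucc_lt_succ).ne]
      · rwa [Equiv.symm_trans_apply, Equiv.symm_swap, Equiv.swap_apply_left]

/-- A monotone sequence stays monotone when a further element is inserted at the right place. -/
lemma exists_orderHom_insert {m N : ℕ} (f : Fin (m + 1) →o Fin N) (a : Fin N) :
    ∃ (j : Fin (m + 2)) (g : Fin (m + 2) →o Fin N), g j = a ∧ ∀ v, g (j.succAbove v) = f v := by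
  let S : Finset (Fin (m + 1)) := {v | f v < a}
  have hS (v : Fin (m + 1)) : f v < a ↔ v.val < S.card := by
    rw [← mem_iff_val_lt_card (fun u w huw hw ↦ ?_)]
    · simp [S]
    · simp only [S, Finset.mem_filter, Finset.mem_univ, true_and] at hw ⊢
      exact (f.monotone huw).trans_lt hw
  have hcard : S.card < m + 2 := by
    have := Finset.card_le_univ S
    rw [Fintype.card_fin] at this
    omega
  let j : Fin (m + 2) := ⟨S.card, hcard⟩
  refine ⟨j, ⟨j.insertNth (α := fun _ ↦ Fin N) a f, fun u w huw ↦ ?_⟩, ?_, fun v ↦ ?_⟩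
  · rcases Fin.eq_self_or_eq_succAbove j u with hu | ⟨u, rfl⟩ <;>
      rcases Fin.eq_self_or_eq_succAbove j w with hw | ⟨w, rfl⟩
    · rw [hu, hw]
    · rw [hu, Fin.insertNth_apply_same, Fin.insertNth_apply_succAbove]
      rw [hu] at huw
      have h1 := lt_of_le_of_ne huw (Fin.succAbove_ne j w).symm
      rw [Fin.lt_succAbove_iff_le_castSucc] at h1
      exact not_lt.1 fun h ↦ absurd ((hS w).1 h) (not_lt.2 h1)
    · rw [hw, Fin.insertNth_apply_same, Fin.insertNth_apply_succAbove]
      rw [hw] at huw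
      have h1 := lt_of_le_of_ne huw (Fin.succAbove_ne j u)
      rw [Fin.succAbove_lt_iff_castSucc_lt] at h1
      exact ((hS u).2 h1).le
    · rw [Fin.insertNth_apply_succAbove, Fin.insertNth_apply_succAbove]
      exact f.monotone ((Fin.strictMono_succAbove j).le_iff_le.1 huw)
  · exact Fin.insertNth_apply_same (α := fun _ ↦ Fin N) j a f
  · exact Fin.insertNth_apply_succAbove (α := fun _ ↦ Fin N) j a f v

lemma exists_ascent {n : ℕ} {τ : Equiv.Perm (Fin (n + 1))} (hτ : τ.symm 0 ≠ Fin.last n) :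
    ∃ k : Fin n, τ.symm k.castSucc < τ.symm k.succ := by
  by_contra! h
  have hanti : Antitone τ.symm := Fin.antitone_iff_succ_le.2 h
  refine hτ (le_antisymm (Fin.le_last _) ?_)
  rw [← τ.symm_apply_apply (Fin.last n)]
  exact hanti (Fin.zero_le _)

/-- Adjoining `φ(τ)` to the filtration fills inner horns: all horns are taken at the vertex of
`φ(τ)` at an ascent of `τ⁻¹`. -/
theorem innerAnodyneExtensions_cubeFiltration {n : ℕ} {τ : Equiv.Perm (Fin (n + 1))}
    (hτ : PermLT τ (finRotate (n + 1))) :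
    SSet.innerAnodyneExtensions (SSet.Subcomplex.homOfLE
      (le_sup_left : cubeFiltration.{u} n τ ≤
        cubeFiltration n τ ⊔ SSet.Subcomplex.ofSimplex (permSimplex τ))) := by
  rw [permLT_finRotate_iff] at hτ
  obtain ⟨k, hk⟩ := exists_ascent hτ
  set a : Fin (n + 2) := k.succ.castSucc with ha
  -- the vertex `a` at an ascent differs from the vertices that detect the previous stage
  have hspecial (s : Fin (n + 2)) (hs : s = 0 ∨ s = Fin.last (n + 1) ∨ IsDescent τ s) :
      s ≠ a := by
    rintro rfl
    rcases hs with hs | hs | ⟨k', hs, hlt⟩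
    · have := congrArg Fin.val hs
      simp [ha] at this
    · have := congrArg Fin.val hs
      rw [ha, Fin.val_castSucc, Fin.val_succ, Fin.val_last] at this
      omega
    · rw [ha, Fin.castSucc_inj, Fin.succ_inj] at hs
      rw [← hs] at hlt
      exact absurd hlt hk.asymm
  have hparam {l : ℕ} {x : (cube.{u} (n + 1)) _⦋l⦌}
      (hx : x ∈ (cubeFiltration n τ ⊔ SSet.Subcomplex.ofSimplex (permSimplex τ)).obj (op ⦋l⦌))
      (hx' : x ∉ (cubeFiltration n τ).obj (op ⦋l⦌)) :
      ∃ f : Fin (l + 1) →o Fin (n + 2), ∀ v, vert x v = vert (permSimplex τ) (f v) :=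
    (mem_ofSimplex_iff_vert _ _).1 (hx.resolve_left hx')
  have hface {l : ℕ} (z : (cube.{u} (n + 1)) _⦋l + 1⦌) (j : Fin (l + 2))
      (hz : z ∈ (cubeFiltration n τ ⊔
        SSet.Subcomplex.ofSimplex (permSimplex τ)).obj (op ⦋l + 1⦌))
      (hj : vert z j = vert (permSimplex τ) a)
      (h : (cube (n + 1)).δ j z ∈ (cubeFiltration n τ).obj (op ⦋l⦌)) :
      z ∈ (cubeFiltration n τ).obj (op ⦋l + 1⦌) := by
    by_contra hz'
    obtain ⟨f, hf⟩ := hparam hz hz'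
    have hfj : f j = a := vert_permSimplex_injective τ ((hf j).symm.trans hj)
    rw [mem_cubeFiltration_iff_exists_not_mem_range hτ
      (f.comp (Fin.succAboveOrderEmb j).toOrderHom) (fun v ↦ by rw [vert_δ, hf]; rfl)] at h
    obtain ⟨s, hs, hs'⟩ := h
    refine hz' ((mem_cubeFiltration_iff_exists_not_mem_range hτ f hf).2 ⟨s, hs, fun v ↦ ?_⟩)
    rcases Fin.eq_self_or_eq_succAbove j v with hv | ⟨v, rfl⟩
    · rw [hv, hfj]
      exact (hspecial s hs).symm
    · exact hs' v
  have key : ∃ h : cubeFiltration.{u} n τ ≤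
      cubeFiltration n τ ⊔ SSet.Subcomplex.ofSimplex (permSimplex τ),
      SSet.innerAnodyneExtensions (SSet.Subcomplex.homOfLE h) := by
    refine cone_induction (P := fun U ↦ ∃ h : cubeFiltration.{u} n τ ≤ U,
      SSet.innerAnodyneExtensions (SSet.Subcomplex.homOfLE h)) le_sup_left
      (vert (permSimplex.{u} τ) a) (fun x hx ↦ ?_) (fun l x hx hx' ↦ ?_)
      (fun l z j hz hj h ↦ hface z j hz hj h) ⟨le_rfl, .of_isIso (𝟙 _)⟩
      (fun U l z j hU _ hP hz hj h hinj hhorn ↦ ?_)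
    · rw [mem_cubeFiltration_iff_exists_not_mem_range hτ (OrderHom.const _ a)
        (fun v ↦ by rw [Fin.eq_zero v, hx]; rfl)]
      exact ⟨0, Or.inl rfl, fun _ h ↦ hspecial 0 (Or.inl rfl) h.symm⟩
    · obtain ⟨f, hf⟩ := hparam hx hx'
      obtain ⟨j, g, hgj, hg⟩ := exists_orderHom_insert f a
      refine ⟨(cube (n + 1)).map (Quiver.Hom.op (SimplexCategory.Hom.mk g : ⦋l + 1⦌ ⟶ ⦋n + 1⦌))
        (permSimplex τ), j, Or.inr ?_, cube_ext fun v ↦ ?_, ?_⟩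
      · exact (SSet.Subcomplex.mem_ofSimplex_obj_iff _ _).2 ⟨_, rfl⟩
      · rw [vert_δ, vert_map, hf, ← hg]
        rfl
      · rw [vert_map]
        exact congrArg _ hgj
    · obtain ⟨hU', hin⟩ := hP
      obtain ⟨f, hf⟩ := hparam hz (fun hz' ↦ h ((cubeFiltration n τ).map
        (SimplexCategory.δ j).op hz'))
      have hfj : f j = a := vert_permSimplex_injective τ ((hf j).symm.trans hj)
      rw [mem_cubeFiltration_iff_exists_not_mem_range hτ
        (f.comp (Fin.succAboveOrderEmb j).toOrderHom) (fun v ↦ by rw [vert_δ, hf]; rfl)] at h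
      push Not at h
      have h0 : 0 < j := by
        obtain ⟨v, hv⟩ := h 0 (Or.inl rfl)
        refine Fin.pos_of_ne_zero fun hj0 ↦ ?_
        have h1 := f.monotone (show j ≤ j.succAbove v by rw [hj0]; exact Fin.zero_le _)
        rw [hfj] at h1
        have h2 : a ≤ 0 := h1.trans hv.le
        exact hspecial 0 (Or.inl rfl) (Fin.le_zero_iff.1 h2).symm
      have h1 : j < Fin.last (l + 1) := by
        obtain ⟨v, hv⟩ := h (Fin.last _) (Or.inr (Or.inl rfl))
        refine Fin.lt_last_iff_ne_last.2 fun hj0 ↦ ?_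
        have h1 := f.monotone (show j.succAbove v ≤ j by rw [hj0]; exact Fin.le_last _)
        rw [hfj] at h1
        have h2 : Fin.last (n + 1) ≤ a := hv.ge.trans h1
        exact hspecial _ (Or.inr (Or.inl rfl)) (Fin.last_le_iff.1 h2).symm
      refine ⟨hU'.trans le_sup_left, ?_⟩
      rw [← SSet.Subcomplex.homOfLE_comp hU' le_sup_left]
      refine MorphismProperty.comp_mem _ _ _ hin ?_
      exact MorphismProperty.of_isPushout
        (isPushout_attach hhorn (mono_yonedaEquiv_symm hinj)) (.horn_ι h0 h1)
  exact key.2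

/-! ### From the left box to `J` -/

lemma permLT_iff {n : ℕ} (τ τ' : Equiv.Perm (Fin n)) :
    PermLT τ τ' ↔ toLex (⇑τ.symm) < toLex (⇑τ'.symm) := Iff.rfl

lemma PermLT.trans {n : ℕ} {τ τ' τ'' : Equiv.Perm (Fin n)} (h : PermLT τ τ') (h' : PermLT τ' τ'') :
    PermLT τ τ'' := by
  rw [permLT_iff] at *
  exact lt_trans h h'

lemma permLT_wellFounded (n : ℕ) : WellFounded (PermLT (n := n)) :=
  InvImage.wf (fun τ : Equiv.Perm (Fin n) ↦ toLex (⇑τ.symm)) wellFounded_lt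

lemma ofSimplex_le_cubeFiltration {n : ℕ} {τ τ' : Equiv.Perm (Fin (n + 1))} (h : PermLT τ' τ) :
    SSet.Subcomplex.ofSimplex (permSimplex.{u} τ') ≤ cubeFiltration n τ :=
  le_sup_of_le_right (le_iSup₂ (f := fun (σ : Equiv.Perm (Fin (n + 1))) (_ : PermLT σ τ) ↦
    SSet.Subcomplex.ofSimplex (permSimplex.{u} σ)) τ' h)

/-- In the linearly ordered set of permutations, each stage of the filtration either is the left
box or arises by adjoining `φ(τ')` for the predecessor `τ'`. -/
lemma cubeFiltration_eq_leftBox_or {n : ℕ} (τ : Equiv.Perm (Fin (n + 1))) :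
    cubeFiltration.{u} n τ = leftBox n ∨ ∃ τ', PermLT τ' τ ∧ cubeFiltration.{u} n τ =
      cubeFiltration n τ' ⊔ SSet.Subcomplex.ofSimplex (permSimplex τ') := by
  by_cases hne : ∃ τ', PermLT τ' τ
  · right
    obtain ⟨τ', hτ', hmax⟩ := (Set.toFinite {τ' | PermLT τ' τ}).exists_maximalFor
      (fun τ' : Equiv.Perm (Fin (n + 1)) ↦ toLex (⇑τ'.symm)) _ hne
    refine ⟨τ', hτ', le_antisymm (sup_le (le_sup_left.trans le_sup_left) ?_)
      (sup_le (sup_le le_sup_left ?_) ?_)⟩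
    · refine iSup₂_le fun σ hσ ↦ ?_
      rcases lt_or_ge (toLex (⇑τ'.symm)) (toLex (⇑σ.symm)) with h | h
      · exact absurd (hmax hσ h.le) (not_le.2 h)
      · rcases h.lt_or_eq with h | h
        · exact (ofSimplex_le_cubeFiltration h).trans le_sup_left
        · have : σ = τ' := Equiv.symm_bijective.injective (DFunLike.coe_injective h)
          rw [this]
          exact le_sup_right
    · exact iSup₂_le fun σ hσ ↦ ofSimplex_le_cubeFiltration (PermLT.trans hσ hτ')
    · exact ofSimplex_le_cubeFiltration hτ'
  · left
    push Not at hne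
    exact le_antisymm (sup_le le_rfl (iSup₂_le fun σ hσ ↦ absurd hσ (hne σ))) le_sup_left

theorem innerAnodyneExtensions_leftBox_cubeFiltration {n : ℕ} (τ : Equiv.Perm (Fin (n + 1)))
    (hτ : ∀ τ', PermLT τ' τ → PermLT τ' (finRotate (n + 1)))
    (h : leftBox.{u} n ≤ cubeFiltration n τ) :
    SSet.innerAnodyneExtensions (SSet.Subcomplex.homOfLE h) := by
  induction τ using (permLT_wellFounded (n + 1)).induction with
  | _ τ ih =>
    rcases cubeFiltration_eq_leftBox_or.{u} τ with h' | ⟨τ', hlt, h'⟩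
    · generalize cubeFiltration.{u} n τ = F at h h'
      subst h'
      exact .of_isIso (𝟙 _)
    · generalize cubeFiltration.{u} n τ = F at h h'
      subst h'
      have e : SSet.Subcomplex.homOfLE h = SSet.Subcomplex.homOfLE
        (le_sup_left : leftBox n ≤ cubeFiltration n τ') ≫ SSet.Subcomplex.homOfLE le_sup_left := rfl
      rw [e]
      exact MorphismProperty.comp_mem _ _ _ (ih τ' hlt (fun σ hσ ↦ hτ σ (hσ.trans hlt)) _)
        (innerAnodyneExtensions_cubeFiltration (hτ τ' hlt))

lemma leftBox_le_cubeJ (n : ℕ) : leftBox.{u} n ≤ cubeJ n := le_sup_left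

theorem innerAnodyneExtensions_leftBox_cubeJ (n : ℕ) :
    SSet.innerAnodyneExtensions (SSet.Subcomplex.homOfLE (leftBox_le_cubeJ.{u} n)) := by
  have key (F : (cube.{u} (n + 1)).Subcomplex) (hF : F = cubeFiltration n (finRotate (n + 1)))
      (h : leftBox.{u} n ≤ F) : SSet.innerAnodyneExtensions (SSet.Subcomplex.homOfLE h) := by
    subst hF
    exact innerAnodyneExtensions_leftBox_cubeFiltration _ (fun _ h ↦ h) h
  exact key _ (cubeJ_eq_cubeFiltration n) _

/-! ### The cone in the cube -/

lemma fin_two_eq_zero_of_ne_one {a : Fin 2} (h : a ≠ 1) : a = 0 := by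
  omega

section ConeMap

variable {n : ℕ} {m : SimplexCategory}

/-- The coordinates in `{0, 1}` of the vertices of a simplex of the cone `Δ⁰ ⋆ Cⁿ` under the map
to `Cⁿ⁺¹`: a vertex on the cone point goes to `(0, …, 0)`, and a vertex `x` of `Cⁿ` goes
to `(x, 1)`. This function gives the coordinate `i < n` of the vertex `v`. -/
def coneCoord (s : JoinSimplex Δ[0] (cube.{u} n) m) (v : Fin (m.len + 1)) (i : Fin n) : Fin 2 :=
  if hv : s.cut.toOrderHom v = 1 then
    vert (s.right ⦋0⦌ (SimplexCategory.const ⦋0⦌ m v) (fun _ ↦ hv)) 0 i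
  else 0

lemma JoinSimplex.right_congr {X Y : SSet.{u}} (s : JoinSimplex X Y m) {k : SimplexCategory}
    {g g' : k ⟶ m} (h : g = g') (hg : ∀ i, (g ≫ s.cut).toOrderHom i = 1)
    (hg' : ∀ i, (g' ≫ s.cut).toOrderHom i = 1) : s.right k g hg = s.right k g' hg' := by
  subst h
  rfl

/-- The simplex of `Cⁿ` contained in a simplex of `Δ⁰ ⋆ Cⁿ` is determined by the coordinates
of its vertices. -/
lemma vert_right (s : JoinSimplex Δ[0] (cube.{u} n) m) {k : ℕ} (g : ⦋k⦌ ⟶ m)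
    (hg : ∀ i, (g ≫ s.cut).toOrderHom i = 1) (v : Fin (k + 1)) (i : Fin n) :
    vert (s.right ⦋k⦌ g hg) v i = coneCoord s (g.toOrderHom v) i := by
  have h1 : s.cut.toOrderHom (g.toOrderHom v) = 1 := hg v
  rw [coneCoord, dif_pos h1]
  have := s.map_right ⦋k⦌ ⦋0⦌ (SimplexCategory.const ⦋0⦌ ⦋k⦌ v) g hg (fun _ ↦ h1)
  rw [s.right_congr (g := SimplexCategory.const ⦋0⦌ m (g.toOrderHom v))
    (g' := SimplexCategory.const ⦋0⦌ ⦋k⦌ v ≫ g) rfl (fun _ ↦ h1) (fun _ ↦ h1), ← this]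
  rfl

lemma coneCoord_monotone (s : JoinSimplex Δ[0] (cube.{u} n) m) : Monotone (coneCoord s) := by
  intro v w h i
  by_cases hv : s.cut.toOrderHom v = 1
  · have hw : s.cut.toOrderHom w = 1 := fin_two_eq_one_of_le (s.cut.toOrderHom.monotone h) hv
    let g : ⦋1⦌ ⟶ m := SimplexCategory.Hom.mk ⟨![v, w], by
      rw [Fin.monotone_iff_le_succ]
      intro j
      rw [Fin.eq_zero j]
      exact h⟩
    have hg : ∀ j, (g ≫ s.cut).toOrderHom j = 1 := by
      intro j
      match j with
      | 0 => exact hv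
      | 1 => exact hw
    have h0 := vert_right s g hg 0 i
    have h1 := vert_right s g hg 1 i
    have h01 := vert_monotone (s.right ⦋1⦌ g hg) (Fin.zero_le 1) i
    rw [h0, h1] at h01
    exact h01
  · rw [coneCoord, dif_neg hv]
    exact Fin.zero_le _

lemma coneCoord_le_cut (s : JoinSimplex Δ[0] (cube.{u} n) m) (v : Fin (m.len + 1)) (i : Fin n) :
    coneCoord s v i ≤ s.cut.toOrderHom v := by
  by_cases hv : s.cut.toOrderHom v = 1
  · rw [hv]
    exact Fin.le_last _
  · rw [coneCoord, dif_neg hv]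
    exact Fin.zero_le _

/-- The vertices of the image in `Cⁿ⁺¹` of a simplex of `Δ⁰ ⋆ Cⁿ`. -/
def coneVert (s : JoinSimplex Δ[0] (cube.{u} n) m) (v : Fin (m.len + 1)) (i : Fin (n + 1)) :
    Fin 2 :=
  if h : i.val < n then coneCoord s v ⟨i, h⟩ else s.cut.toOrderHom v

lemma coneVert_monotone (s : JoinSimplex Δ[0] (cube.{u} n) m) : Monotone (coneVert s) := by
  intro v w h i
  unfold coneVert
  split_ifs
  · exact coneCoord_monotone s h _
  · exact s.cut.toOrderHom.monotone h

lemma coneVert_castSucc (s : JoinSimplex Δ[0] (cube.{u} n) m) (v : Fin (m.len + 1))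
    (i : Fin n) : coneVert s v i.castSucc = coneCoord s v i := dif_pos i.isLt

lemma coneVert_last (s : JoinSimplex Δ[0] (cube.{u} n) m) (v : Fin (m.len + 1)) :
    coneVert s v (Fin.last n) = s.cut.toOrderHom v := dif_neg (lt_irrefl n)

variable (n) in
/-- The map `Δ⁰ ⋆ Cⁿ → Cⁿ⁺¹` that sends the cone point to `(0, …, 0)` and
restricts to `x ↦ (x, 1)` on `Cⁿ`. -/
def coneToCube : join Δ[0] (cube.{u} n) ⟶ cube.{u} (n + 1) where
  app m := ↾ fun (s : JoinSimplex Δ[0] (cube.{u} n) m.unop) ↦ (fun i ↦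
    SSet.stdSimplex.objMk (n := ⦋1⦌) (m := m)
      ⟨fun v ↦ coneVert s v i, fun _ _ h ↦ coneVert_monotone s h i⟩ :
      Fin (n + 1) → (Δ[1] : SSet.{u}).obj m)
  naturality _ _ _ := rfl

lemma vert_coneToCube {m : ℕ} (s : JoinSimplex Δ[0] (cube.{u} n) ⦋m⦌) (v : Fin (m + 1)) :
    vert ((coneToCube n).app (op ⦋m⦌) s) v = coneVert s v := rfl

instance : Mono (coneToCube.{u} n) := by
  rw [NatTrans.mono_iff_mono_app]
  rintro ⟨⟨m⟩⟩
  rw [mono_iff_injective]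
  intro (s : JoinSimplex Δ[0] (cube.{u} n) ⦋m⦌) (t : JoinSimplex Δ[0] (cube.{u} n) ⦋m⦌) h
  have hv (v : Fin (m + 1)) : coneVert s v = coneVert t v :=
    congrArg (fun x : (cube.{u} (n + 1)) _⦋m⦌ ↦ vert x v) h
  refine JoinSimplex.ext' ?_ (fun k g _ _ ↦ ?_) (fun k g _ _ ↦ ?_)
  · ext v : 3
    exact (coneVert_last s v).symm.trans ((congrFun (hv v) _).trans (coneVert_last t v))
  · induction k using SimplexCategory.rec with | _ k
    exact SSet.stdSimplex.ext _ _ fun _ ↦ Subsingleton.elim (α := Fin 1) _ _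
  · induction k using SimplexCategory.rec with | _ k
    refine cube_ext fun v ↦ funext fun i ↦ ?_
    rw [vert_right, vert_right, ← coneVert_castSucc, ← coneVert_castSucc]
    exact congrFun (hv _) _

lemma joinInl_coneToCube :
    joinInl _ _ ≫ coneToCube.{u} n = SSet.const (cubeZero (n + 1)) := by
  ext ⟨⟨m⟩⟩ x
  refine cube_ext fun v ↦ funext fun i ↦ ?_
  change coneVert (m := ⦋m⦌) _ v i = 0
  unfold coneVert
  split_ifs
  · exact dif_neg (fun h : (0 : Fin 2) = 1 ↦ absurd h (by decide))
  · rfl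

lemma joinInr_coneToCube : joinInr _ _ ≫ coneToCube.{u} n = rightFaceInclusion n := by
  ext ⟨⟨m⟩⟩ (x : (cube.{u} n) _⦋m⦌)
  refine cube_ext fun v ↦ funext fun i ↦ ?_
  change coneVert (m := ⦋m⦌) _ v i = (dite _ _ _ : (Δ[1] : SSet.{u}) _⦋m⦌) v
  unfold coneVert
  split_ifs
  · rfl
  · rfl

lemma coneToCube_joinEdge :
    (coneToCube.{u} n).app _ (joinEdge (SSet.stdSimplex.const 0 0 _) (cubeZero n)) =
      cubeInitialEdge n := by
  refine cube_ext fun v ↦ funext fun i ↦ ?_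
  change coneVert (m := ⦋1⦌) _ v i = (ite _ _ _ : (Δ[1] : SSet.{u}) _⦋1⦌) v
  unfold coneVert
  have : i = Fin.last n ↔ ¬ i.val < n := by
    rw [Fin.ext_iff, Fin.val_last]
    omega
  rw [if_congr this rfl rfl]
  split_ifs
  · unfold coneCoord
    split_ifs
    · rfl
    · rfl
  · match v with
    | 0 => rfl
    | 1 => rfl

lemma mem_range_coneToCube_iff {m : ℕ} (x : (cube.{u} (n + 1)) _⦋m⦌) :
    x ∈ (SSet.Subcomplex.range (coneToCube n)).obj (op ⦋m⦌) ↔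
      ∀ v i, vert x v i ≤ vert x v (Fin.last n) := by
  constructor
  · rintro ⟨(s : JoinSimplex Δ[0] (cube.{u} n) ⦋m⦌), rfl⟩ v i
    change coneVert s v i ≤ coneVert s v (Fin.last n)
    rw [coneVert_last]
    induction i using Fin.lastCases with
    | last => rw [coneVert_last]
    | cast i =>
      rw [coneVert_castSucc]
      exact coneCoord_le_cut _ _ _
  · intro h
    let s : JoinSimplex Δ[0] (cube.{u} n) ⦋m⦌ :=
      { cut := SSet.stdSimplex.objEquiv (x (Fin.last n))
        left := fun k _ _ ↦ SSet.stdSimplex.const 0 0 (op k)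
        right := fun k g _ i ↦ (Δ[1] : SSet.{u}).map g.op (x i.castSucc)
        map_left := fun _ _ _ _ _ _ ↦ rfl
        map_right := fun _ _ _ _ _ _ ↦ rfl }
    refine ⟨s, cube_ext fun v ↦ funext fun i ↦ ?_⟩
    have hlast : s.cut.toOrderHom v = vert x v (Fin.last n) := rfl
    rw [vert_coneToCube]
    induction i using Fin.lastCases with
    | last => rw [coneVert_last, hlast]
    | cast i =>
      rw [coneVert_castSucc, coneCoord]
      split_ifs with hv
      · rfl
      · have h1 := h v i.castSucc
        rw [← hlast, fin_two_eq_zero_of_ne_one hv] at h1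
        exact (Fin.le_zero_iff.1 h1).symm

lemma mem_range_coneInclusion_iff {m : ℕ} (s : JoinSimplex Δ[0] (cube.{u} n) ⦋m⦌) :
    s ∈ Set.range ((coneInclusion n).app (op ⦋m⦌)) ↔
      ∀ k g hg, s.right k g hg ∈ (cubeBoundary n).obj (op k) := by
  constructor
  · rintro ⟨t, rfl⟩ k g hg
    exact (JoinSimplex.right t k g hg).2
  · intro h
    exact ⟨({ cut := s.cut
              left := s.left
              right := fun k g hg ↦ ⟨s.right k g hg, h k g hg⟩
              map_left := s.map_left
              map_right := fun k l h' g hg hhg ↦ Subtype.ext (s.map_right k l h' g hg hhg) } :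
      JoinSimplex Δ[0] (cubeBoundary.{u} n) ⦋m⦌), rfl⟩

/-- The preimage of `J` in the cone is the cone on the boundary: if a coordinate is constant on the
vertices in `Cⁿ`, then in `Cⁿ⁺¹` it is either constantly `0` or equal to the last coordinate. -/
lemma coneToCube_mem_cubeJ_iff {m : ℕ} (s : JoinSimplex Δ[0] (cube.{u} n) ⦋m⦌) :
    (coneToCube n).app (op ⦋m⦌) s ∈ (cubeJ n).obj (op ⦋m⦌) ↔
      s ∈ Set.range ((coneInclusion n).app (op ⦋m⦌)) := by
  rw [mem_cubeJ_iff, mem_range_coneInclusion_iff, mem_leftBox_iff]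
  simp only [vert_coneToCube, coneVert_last]
  constructor
  · intro h k g hg
    induction k using SimplexCategory.rec with | _ k
    rw [mem_cubeBoundary_iff]
    rcases h with ⟨i, j, hij, h⟩ | ⟨i, hi, h⟩
    · induction i using Fin.lastCases with
      | last =>
        have h1 := h (g.toOrderHom 0)
        have h2 : s.cut.toOrderHom (g.toOrderHom 0) = 1 := hg 0
        rw [coneVert_last, h2, hij.resolve_left (not_not.2 rfl)] at h1
        exact absurd h1 (by decide)
      | cast i =>
        refine ⟨i, j, fun v ↦ ?_⟩
        rw [vert_right, ← coneVert_castSucc, h]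
    · obtain ⟨i, rfl⟩ := Fin.exists_castSucc_eq.2 hi
      refine ⟨i, 1, fun v ↦ ?_⟩
      rw [vert_right, ← coneVert_castSucc]
      exact fin_two_eq_one_of_le (h _) (hg v)
  · intro h
    by_cases hcut : ∃ v, s.cut.toOrderHom v = 1
    · -- retract `[m]` onto the vertices in `Cⁿ`, of which `v₀` is the first one
      obtain ⟨v₀, hv₀, hmin⟩ := (Set.toFinite {v | s.cut.toOrderHom v = 1}).exists_minimal hcut
      let g : ⦋m⦌ ⟶ ⦋m⦌ := SimplexCategory.Hom.mk
        ⟨fun v : Fin (m + 1) ↦ max v v₀, fun _ _ h ↦ max_le_max h le_rfl⟩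
      have hg : ∀ v, (g ≫ s.cut).toOrderHom v = 1 := fun v ↦
        fin_two_eq_one_of_le (s.cut.toOrderHom.monotone (le_max_right v v₀)) hv₀
      have hb := h _ g hg
      rw [mem_cubeBoundary_iff] at hb
      obtain ⟨i, j, hb⟩ := hb
      have key (v : Fin (m + 1)) (hv : s.cut.toOrderHom v = 1) : coneCoord s v i = j := by
        have h1 := hb v
        have h2 : g.toOrderHom v = v := max_eq_left (by
          by_contra h'
          exact h' (hmin hv (not_le.1 h').le))
        rw [vert_right, h2] at h1
        exact h1
      by_cases hj : j = 0
      · refine Or.inl ⟨i.castSucc, 0, Or.inr rfl, fun v ↦ ?_⟩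
        rw [coneVert_castSucc]
        by_cases hv : s.cut.toOrderHom v = 1
        · rw [key v hv, hj]
        · exact dif_neg hv
      · refine Or.inr ⟨i.castSucc, (Fin.castSucc_lt_last i).ne, fun v ↦ ?_⟩
        rw [coneVert_castSucc]
        by_cases hv : s.cut.toOrderHom v = 1
        · rw [key v hv, hv]
          omega
        · rw [fin_two_eq_zero_of_ne_one hv]
          exact Fin.zero_le _
    · push Not at hcut
      refine Or.inl ⟨Fin.last n, 0, Or.inr rfl, fun v ↦ ?_⟩
      rw [coneVert_last]
      exact fin_two_eq_zero_of_ne_one (hcut v)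

lemma mem_cubeJ_or_mem_range_coneToCube {m : ℕ} (x : (cube.{u} (n + 1)) _⦋m⦌) :
    x ∈ (cubeJ n).obj (op ⦋m⦌) ∨ x ∈ Set.range ((coneToCube n).app (op ⦋m⦌)) := by
  by_cases h : ∀ v i, vert x v i ≤ vert x v (Fin.last n)
  · exact Or.inr ((mem_range_coneToCube_iff x).2 h)
  · left
    push Not at h
    obtain ⟨v₀, i, h⟩ := h
    rw [mem_cubeJ_iff]
    refine Or.inr ⟨i, ?_, fun v ↦ ?_⟩
    · rintro rfl
      exact lt_irrefl _ h
    · rcases le_total v v₀ with hv | hv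
      · have : vert x v (Fin.last n) ≤ vert x v₀ (Fin.last n) := vert_monotone x hv _
        omega
      · have : vert x v₀ i ≤ vert x v i := vert_monotone x hv _
        omega

instance : Mono (coneInclusion.{u} n) := by
  rw [NatTrans.mono_iff_mono_app]
  rintro ⟨⟨m⟩⟩
  rw [mono_iff_injective]
  intro (s : JoinSimplex Δ[0] (cubeBoundary.{u} n) ⦋m⦌)
    (t : JoinSimplex Δ[0] (cubeBoundary.{u} n) ⦋m⦌) h
  have h' : (coneInclusion n).app (op ⦋m⦌) s = (coneInclusion n).app (op ⦋m⦌) t := h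
  obtain ⟨c, l, r, _, _⟩ := s
  obtain ⟨c', l', r', _, _⟩ := t
  have hc : c = c' := congrArg JoinSimplex.cut h'
  subst hc
  have hl : l = l' := eq_of_heq (JoinSimplex.mk.inj h').2.1
  have hr := eq_of_heq (JoinSimplex.mk.inj h').2.2
  subst hl
  refine JoinSimplex.ext' rfl (fun _ _ _ _ ↦ rfl) (fun k g hs ht ↦ Subtype.ext ?_)
  exact congrFun (congrFun (congrFun hr k) g) hs

variable (n) in
/-- The restriction `Δ⁰ ⋆ ∂Cⁿ → Jⁿ⁺¹` of the map `Δ⁰ ⋆ Cⁿ → Cⁿ⁺¹`. -/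
def coneBoundaryToJ : join Δ[0] (cubeBoundary.{u} n) ⟶ (cubeJ.{u} n : SSet.{u}) :=
  SSet.Subcomplex.lift (coneInclusion n ≫ coneToCube n) (by
    rintro ⟨⟨m⟩⟩ _ ⟨s, rfl⟩
    exact (coneToCube_mem_cubeJ_iff _).2 ⟨s, rfl⟩)

lemma coneBoundaryToJ_ι :
    coneBoundaryToJ.{u} n ≫ (cubeJ n).ι = coneInclusion n ≫ coneToCube n := rfl

instance : Mono (coneBoundaryToJ.{u} n) :=
  have : Mono (coneBoundaryToJ.{u} n ≫ (cubeJ n).ι) := by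
    rw [coneBoundaryToJ_ι]
    infer_instance
  mono_of_mono _ (cubeJ n).ι

theorem isPushout_cone :
    IsPushout (coneInclusion.{u} n) (coneBoundaryToJ n) (coneToCube n) (cubeJ n).ι := by
  refine (isPushout_of_mono coneBoundaryToJ_ι (fun m x s h ↦ ?_) (fun m x ↦ ?_)).flip
  · exact (coneToCube_mem_cubeJ_iff _).1
      (Eq.subst (motive := fun y ↦ y ∈ (cubeJ n).obj (op ⦋m⦌)) h x.2)
  · rcases mem_cubeJ_or_mem_range_coneToCube x with h | h
    · exact Or.inl ⟨⟨x, h⟩, rfl⟩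
    · exact Or.inr h

end ConeMap

/-! ### Marked horns and the cone -/

namespace MarkedSSet

/-- A square of marked simplicial sets is a pushout square if the underlying square is one and
each marked edge of the target comes from a marked edge of one of the two sides. -/
lemma isPushout_of_toSSet {A B C D : MarkedSSet.{u}} {t : A ⟶ B} {l : A ⟶ C} {r : B ⟶ D}
    {b : C ⟶ D} (sq : IsPushout (Hom.map t) (Hom.map l) (Hom.map r) (Hom.map b))
    (hD : ∀ e ∈ D.marked, (∃ e' ∈ B.marked, (Hom.map r).app _ e' = e) ∨
      ∃ e' ∈ C.marked, (Hom.map b).app _ e' = e) : IsPushout t l r b where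
  w := Hom.ext sq.w
  isColimit' := ⟨PushoutCocone.IsColimit.mk (Hom.ext sq.w)
    (fun s ↦ Hom.mk (sq.desc (Hom.map s.inl) (Hom.map s.inr)
      (congrArg Hom.map s.condition)) (fun e he ↦ by
        rcases hD e he with ⟨e', he', rfl⟩ | ⟨e', he', rfl⟩
        · have := congrArg (fun f ↦ f.app _ e') (sq.inl_desc (Hom.map s.inl) (Hom.map s.inr)
            (congrArg Hom.map s.condition))
          exact Eq.subst (motive := fun y ↦ y ∈ s.pt.marked) this.symm
            (Hom.map_marked s.inl e' he')
        · have := congrArg (fun f ↦ f.app _ e') (sq.inr_desc (Hom.map s.inl) (Hom.map s.inr)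
            (congrArg Hom.map s.condition))
          exact Eq.subst (motive := fun y ↦ y ∈ s.pt.marked) this.symm
            (Hom.map_marked s.inr e' he')))
    (fun s ↦ Hom.ext (sq.inl_desc _ _ _))
    (fun s ↦ Hom.ext (sq.inr_desc _ _ _))
    (fun s m h₁ h₂ ↦ Hom.ext (sq.hom_ext
      ((congrArg Hom.map h₁).trans (sq.inl_desc _ _ _).symm)
      ((congrArg Hom.map h₂).trans (sq.inr_desc _ _ _).symm)))⟩

end MarkedSSet

open MarkedSSet

/-- A subcomplex of `Cⁿ⁺¹`, where the degenerate edges and, if it belongs to the subcomplex, the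
edge `(0, …, 0, 0) → (0, …, 0, 1)` are marked. -/
def markedSubcomplex {n : ℕ} (U : (cube.{u} (n + 1)).Subcomplex) : MarkedSSet.{u} :=
  (withEdges (cube.{u} (n + 1)) {cubeInitialEdge n}).restrict U.ι

/-- The inclusion of subcomplexes of `Cⁿ⁺¹`, as a morphism of marked simplicial sets. -/
def markedHomOfLE {n : ℕ} {U V : (cube.{u} (n + 1)).Subcomplex} (h : U ≤ V) :
    markedSubcomplex U ⟶ markedSubcomplex V :=
  Hom.mk (SSet.Subcomplex.homOfLE h) (fun _ he ↦ he)

/-- Adjoining to `U` a nondegenerate simplex with marked first edge that meets `U` in the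
horn `Λ₀` is a pushout of a left horn inclusion of marked simplicial sets. -/
lemma markedHomOfLE_attach {n m : ℕ} {W : MorphismProperty MarkedSSet.{u}}
    [W.IsStableUnderCobaseChange] (hW : AnodyneGenerators ≤ W)
    {U : (cube.{u} (n + 1)).Subcomplex} {z : (cube.{u} (n + 1)) _⦋m + 1⦌}
    (hz : Function.Injective (vert z))
    (h : U.preimage (SSet.yonedaEquiv.symm z) = SSet.horn (m + 1) 0)
    (h0 : vert z 0 = 0) (h1 : ∀ i, vert z 1 i = if i = Fin.last n then 1 else 0) :
    W (markedHomOfLE (le_sup_left : U ≤ U ⊔ SSet.Subcomplex.ofSimplex z)) := by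
  have hmono := mono_yonedaEquiv_symm hz
  have hedge : (SSet.yonedaEquiv.symm z).app _
      (SSet.stdSimplex.edge (m + 1) 0 1 (Fin.zero_le _)) = cubeInitialEdge n := by
    refine cube_ext fun v ↦ funext fun i ↦ ?_
    match v with
    | 0 =>
      refine (congrFun h0 i).trans ?_
      change _ = (ite _ _ _ : (Δ[1] : SSet.{u}) _⦋1⦌) 0
      split_ifs <;> rfl
    | 1 =>
      refine (h1 i).trans ?_
      change _ = (ite _ _ _ : (Δ[1] : SSet.{u}) _⦋1⦌) 1
      split_ifs <;> rfl
  have hmarked (e : (Δ[m + 1] : SSet.{u}) _⦋1⦌)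
      (he : e ∈ (withEdges (Δ[m + 1] : SSet.{u})
        {SSet.stdSimplex.edge (m + 1) 0 1 (Fin.zero_le _)}).marked) :
      (SSet.yonedaEquiv.symm z).app _ e ∈
        (withEdges (cube.{u} (n + 1)) {cubeInitialEdge n}).marked := by
    rcases he with he | rfl
    · exact Or.inl (SSet.degenerate_app_apply he _)
    · exact Or.inr hedge
  refine MorphismProperty.of_isPushout (f' := markedHomOfLE le_sup_left)
    (isPushout_of_toSSet
      (t := (Hom.mk (hornToSubcomplex h) (fun e he ↦ hmarked _ he) :
        (withEdges (Δ[m + 1] : SSet.{u})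
        {SSet.stdSimplex.edge (m + 1) 0 1 (Fin.zero_le _)}).restrict _ ⟶ markedSubcomplex U))
      (b := (Hom.mk (simplexToSup U z) (fun e he ↦ hmarked _ he) :
        withEdges (Δ[m + 1] : SSet.{u}) {SSet.stdSimplex.edge (m + 1) 0 1 (Fin.zero_le _)} ⟶
          markedSubcomplex (U ⊔ SSet.Subcomplex.ofSimplex z)))
      (isPushout_attach h hmono) ?_) (hW _ (AnodyneGenerators.left m))
  rintro ⟨e, he | he⟩ hem
  · exact Or.inl ⟨⟨e, he⟩, hem, rfl⟩
  · right
    rcases hem with hem | hem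
    · obtain ⟨f, rfl⟩ := (SSet.Subcomplex.mem_ofSimplex_obj_iff _ _).1 he
      refine ⟨SSet.stdSimplex.objEquiv.symm f, Or.inl ?_, rfl⟩
      exact (SSet.degenerate_iff_of_mono (SSet.yonedaEquiv.symm z) _).1 hem
    · exact ⟨_, Or.inr rfl, Subtype.ext (hedge.trans (Eq.symm hem))⟩

lemma exists_vert_zero_succ {n m : ℕ} (x : (cube.{u} n) _⦋m⦌) :
    ∃ z : (cube.{u} n) _⦋m + 1⦌, vert z 0 = (fun _ ↦ 0) ∧ ∀ v, vert z v.succ = vert x v := by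
  let g : Fin (m + 2) → Fin n → Fin 2 :=
    Fin.cons (α := fun _ ↦ Fin n → Fin 2) (fun _ ↦ 0) (vert x)
  have hg : Monotone g := by
    intro v w hvw
    induction v using Fin.cases with
    | zero => exact fun i ↦ Fin.zero_le _
    | succ v =>
      induction w using Fin.cases with
      | zero => exact absurd hvw (not_le.2 (Fin.succ_pos v))
      | succ w => exact vert_monotone x (Fin.succ_le_succ_iff.1 hvw)
  exact ⟨ofVert g hg, rfl, fun v ↦ rfl⟩

/-- The image of the cone `Δ⁰ ⋆ Cⁿ` is obtained from its intersection with `J` by filling left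
horns with marked first edge: all horns are taken at the vertex `(0, …, 0)`, and a simplex of the
cone that is neither in `J` nor contains this vertex starts at `(0, …, 0, 1)`. -/
theorem markedHomOfLE_cubeJ_inf_range {n : ℕ} {W : MorphismProperty MarkedSSet.{u}}
    [W.IsStableUnderCobaseChange] [W.IsMultiplicative] (hW : AnodyneGenerators ≤ W) :
    W (markedHomOfLE (inf_le_right : cubeJ n ⊓ SSet.Subcomplex.range (coneToCube.{u} n) ≤ _)) := by
  have hJ {m : ℕ} (x : (cube.{u} (n + 1)) _⦋m⦌) : x ∈ (cubeJ n).obj (op ⦋m⦌) ↔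
      (∃ i, ∀ v, vert x v i = 0) ∨
        ∃ i ≠ Fin.last n, ∀ v, vert x v (Fin.last n) ≤ vert x v i := by
    rw [mem_cubeJ_iff, mem_leftBox_iff]
    constructor
    · rintro (⟨i, j, hij, h⟩ | h)
      · by_cases hj : j = 0
        · exact Or.inl ⟨i, hj ▸ h⟩
        · refine Or.inr ⟨i, hij.resolve_right hj, fun v ↦ ?_⟩
          rw [h v]
          omega
      · exact Or.inr h
    · rintro (⟨i, h⟩ | h)
      · exact Or.inl ⟨i, 0, Or.inr rfl, h⟩
      · exact Or.inr h
  have key : ∃ h : cubeJ n ⊓ SSet.Subcomplex.range (coneToCube.{u} n) ≤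
      SSet.Subcomplex.range (coneToCube.{u} n), W (markedHomOfLE h) := by
    refine cone_induction (P := fun U ↦ ∃ h : cubeJ n ⊓
      SSet.Subcomplex.range (coneToCube.{u} n) ≤ U, W (markedHomOfLE h)) inf_le_right
      (fun _ ↦ 0) (fun x hx ↦ ⟨?_, ?_⟩) (fun m x hx _ ↦ ?_) (fun m z k hz hk h ↦ ⟨?_, hz⟩)
      ⟨le_rfl, W.id_mem _⟩ (fun U m z k hU hUB hP hz hk h hinj hhorn ↦ ?_)
    · exact (hJ x).2 (Or.inl ⟨0, fun v ↦ by rw [Fin.eq_zero v, hx]⟩)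
    · rw [mem_range_coneToCube_iff]
      intro v i
      rw [Fin.eq_zero v, hx]
    · rw [mem_range_coneToCube_iff] at hx
      obtain ⟨z, hz0, hz⟩ := exists_vert_zero_succ x
      refine ⟨z, 0, ?_, cube_ext fun v ↦ ?_, hz0⟩
      · rw [mem_range_coneToCube_iff]
        intro v i
        induction v using Fin.cases with
        | zero => rw [hz0]
        | succ v =>
          rw [hz]
          exact hx v i
      · rw [vert_δ, Fin.succAbove_zero, hz]
    · have h := (hJ _).1 h.1
      rw [hJ]
      refine h.imp (fun ⟨i, h⟩ ↦ ⟨i, fun v ↦ ?_⟩) (fun ⟨i, hi, h⟩ ↦ ⟨i, hi, fun v ↦ ?_⟩)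
      · rcases Fin.eq_self_or_eq_succAbove k v with rfl | ⟨v, rfl⟩
        · rw [hk]
        · exact h v
      · rcases Fin.eq_self_or_eq_succAbove k v with rfl | ⟨v, rfl⟩
        · rw [hk]
        · exact h v
    · obtain ⟨hU', hWU⟩ := hP
      have hδ : ¬ (cube (n + 1)).δ k z ∈ (cubeJ n).obj (op ⦋m⦌) := fun h' ↦
        h ⟨h', (SSet.Subcomplex.range (coneToCube n)).map (SimplexCategory.δ k).op hz⟩
      have h0 : vert z 0 = 0 := by
        funext i
        have := vert_monotone z (Fin.zero_le k) i
        rw [hk] at this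
        exact Fin.le_zero_iff.1 this
      obtain rfl : k = 0 := hinj (hk.trans h0.symm)
      rw [mem_range_coneToCube_iff] at hz
      have h1 (i : Fin (n + 1)) : vert z 1 i = if i = Fin.last n then 1 else 0 := by
        split_ifs with hi
        · rw [hi]
          by_contra hne
          have : vert z 1 = vert z 0 := by
            funext j
            have := hz 1 j
            rw [fin_two_eq_zero_of_ne_one hne] at this
            rw [h0]
            exact Fin.le_zero_iff.1 this
          exact absurd (hinj this) Fin.zero_ne_one.symm
        · by_contra hne
          refine hδ ((hJ _).2 (Or.inr ⟨i, hi, fun v ↦ ?_⟩))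
          have h2 : vert z 1 i ≤ vert z ((0 : Fin (m + 2)).succAbove v) i := by
            refine vert_monotone z ?_ i
            rw [Fin.succAbove_zero]
            exact Fin.succ_le_succ_iff.2 (Fin.zero_le v)
          rw [vert_δ]
          omega
      refine ⟨hU'.trans le_sup_left, ?_⟩
      exact W.comp_mem _ _ hWU (markedHomOfLE_attach hW hinj hhorn h0 h1)
  exact key.2

section Transport

variable (n : ℕ)

/-- The cone `Δ⁰ ⋆ ∂Cⁿ` is the intersection of `J` with the image of `Δ⁰ ⋆ Cⁿ`. -/
def coneBoundaryToInf : join Δ[0] (cubeBoundary.{u} n) ⟶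
    (cubeJ n ⊓ SSet.Subcomplex.range (coneToCube.{u} n) : (cube.{u} (n + 1)).Subcomplex) :=
  SSet.Subcomplex.lift (coneInclusion n ≫ coneToCube n) (by
    rintro m _ ⟨s, rfl⟩
    exact ⟨((coneBoundaryToJ n).app m s).2, ⟨_, rfl⟩⟩)

instance : IsIso (coneBoundaryToInf.{u} n) := by
  have : Mono (coneBoundaryToInf.{u} n) :=
    have : Mono (coneBoundaryToInf.{u} n ≫ SSet.Subcomplex.ι _) :=
      inferInstanceAs (Mono (coneInclusion.{u} n ≫ coneToCube n))
    mono_of_mono _ (SSet.Subcomplex.ι _)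
  have : Epi (coneBoundaryToInf.{u} n) := by
    rw [NatTrans.epi_iff_epi_app]
    rintro ⟨⟨m⟩⟩
    rw [epi_iff_surjective]
    rintro ⟨_, hJ, ⟨s, rfl⟩⟩
    obtain ⟨t, rfl⟩ := (coneToCube_mem_cubeJ_iff s).1 hJ
    exact ⟨t, rfl⟩
  exact isIso_of_mono_of_epi _

theorem markedAnodyne_coneInclusion :
    markedAnodyne (restrictHom (markedCone.{u} n) (coneInclusion n)) := by
  intro W _ _ _ hW
  have hinj : Function.Injective ((coneToCube.{u} n).app (op ⦋1⦌)) :=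
    injective_of_mono ((coneToCube.{u} n).app (op ⦋1⦌))
  have hmarked (e : (join Δ[0] (cube.{u} n)) _⦋1⦌) : e ∈ (markedCone n).marked ↔
      (coneToCube n).app _ e ∈ (withEdges (cube.{u} (n + 1)) {cubeInitialEdge n}).marked := by
    refine or_congr (SSet.degenerate_iff_of_mono (coneToCube n) e).symm ?_
    rw [Set.mem_singleton_iff, Set.mem_singleton_iff, ← coneToCube_joinEdge, hinj.eq_iff]
  let t := inv (coneBoundaryToInf.{u} n)
  let b := inv (SSet.Subcomplex.toRange (coneToCube.{u} n))
  have ht : t ≫ coneInclusion n ≫ coneToCube n = SSet.Subcomplex.ι _ := by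
    change t ≫ (coneBoundaryToInf.{u} n ≫ SSet.Subcomplex.ι _) = _
    rw [IsIso.inv_hom_id_assoc]
  have hb : b ≫ coneToCube n = SSet.Subcomplex.ι _ := by
    change b ≫ (SSet.Subcomplex.toRange (coneToCube.{u} n) ≫ SSet.Subcomplex.ι _) = _
    rw [IsIso.inv_hom_id_assoc]
  have hw : t ≫ coneInclusion n = SSet.Subcomplex.homOfLE inf_le_right ≫ b := by
    rw [← cancel_mono (coneToCube n), Category.assoc, Category.assoc, ht, hb]
    rfl
  have sq : IsPushout t (SSet.Subcomplex.homOfLE inf_le_right) (coneInclusion n) b :=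
    IsPushout.of_horiz_isIso ⟨hw⟩
  refine MorphismProperty.of_isPushout (isPushout_of_toSSet
    (t := (Hom.mk t (fun e he ↦ ?_) : markedSubcomplex _ ⟶ (markedCone n).restrict _))
    (b := (Hom.mk b (fun e he ↦ ?_) : markedSubcomplex _ ⟶ markedCone n))
    (l := markedHomOfLE inf_le_right)
    (r := restrictHom (markedCone n) (coneInclusion n)) sq (fun e he ↦ Or.inr ?_))
    (markedHomOfLE_cubeJ_inf_range hW)
  · refine (hmarked _).2 ?_
    have := congrArg (fun f ↦ f.app _ e) ht
    exact Eq.subst (motive := fun y ↦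
      y ∈ (withEdges (cube.{u} (n + 1)) {cubeInitialEdge n}).marked) this.symm he
  · refine (hmarked _).2 ?_
    have := congrArg (fun f ↦ f.app _ e) hb
    exact Eq.subst (motive := fun y ↦
      y ∈ (withEdges (cube.{u} (n + 1)) {cubeInitialEdge n}).marked) this.symm he
  · refine ⟨(SSet.Subcomplex.toRange (coneToCube.{u} n)).app _ e, (hmarked e).1 he, ?_⟩
    exact congrArg (fun f ↦ f.app (op ⦋1⦌) e)
      (IsIso.hom_inv_id (SSet.Subcomplex.toRange (coneToCube.{u} n)))

end Transport

end CubeFilling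

theorem mainTheorem2 (n : ℕ) :
    ∃ h : CubeFilling.leftBox.{u} n ≤ CubeFilling.cubeJ n,
      SSet.Subcomplex.homOfLE h ≫ (CubeFilling.cubeJ n).ι = (CubeFilling.leftBox n).ι ∧
      SSet.innerAnodyneExtensions (SSet.Subcomplex.homOfLE h) ∧
      CubeFilling.cubeJ.{u} n = CubeFilling.cubeFiltration n (finRotate (n + 1)) ∧
      (∀ τ : Equiv.Perm (Fin (n + 1)), CubeFilling.PermLT τ (finRotate (n + 1)) →
        SSet.innerAnodyneExtensions (SSet.Subcomplex.homOfLE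
          (le_sup_left : CubeFilling.cubeFiltration.{u} n τ ≤
            CubeFilling.cubeFiltration n τ ⊔
              SSet.Subcomplex.ofSimplex (CubeFilling.permSimplex τ)))) ∧
      (∃ (a : CubeFilling.join (Δ[0] : SSet.{u}) (CubeFilling.cubeBoundary.{u} n) ⟶
            (CubeFilling.cubeJ.{u} n : SSet.{u}))
         (b : CubeFilling.join (Δ[0] : SSet.{u}) (CubeFilling.cube.{u} n) ⟶
            CubeFilling.cube.{u} (n + 1)),
        Mono a ∧ Mono b ∧ Mono (CubeFilling.coneInclusion.{u} n) ∧
        CubeFilling.joinInl _ _ ≫ b = SSet.const (CubeFilling.cubeZero (n + 1)) ∧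
        CubeFilling.joinInr _ _ ≫ b = CubeFilling.rightFaceInclusion n ∧
        b.app _ (CubeFilling.joinEdge (SSet.stdSimplex.const 0 0 _) (CubeFilling.cubeZero n)) =
          CubeFilling.cubeInitialEdge n ∧
        IsPushout (CubeFilling.coneInclusion n) a b (CubeFilling.cubeJ n).ι) ∧
      CubeFilling.MarkedSSet.markedAnodyne
        (CubeFilling.MarkedSSet.restrictHom (CubeFilling.markedCone.{u} n)
          (CubeFilling.coneInclusion n)) :=
  ⟨CubeFilling.leftBox_le_cubeJ n, rfl, CubeFilling.innerAnodyneExtensions_leftBox_cubeJ n,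
    CubeFilling.cubeJ_eq_cubeFiltration n,
    fun _ hτ ↦ CubeFilling.innerAnodyneExtensions_cubeFiltration hτ,
    ⟨CubeFilling.coneBoundaryToJ n, CubeFilling.coneToCube n, inferInstance, inferInstance,
      inferInstance, CubeFilling.joinInl_coneToCube, CubeFilling.joinInr_coneToCube,
      CubeFilling.coneToCube_joinEdge, CubeFilling.isPushout_cone⟩,
    CubeFilling.markedAnodyne_coneInclusion n⟩
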